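/- Let $\mathbb K$ be a field. A \emph{compatible associative algebra} is a vector space $A$ with two bilinear associative products $\cdot,\circ$ whose sum $\cdot+\circ$ is associative. A \emph{compatible infinitesimal bialgebra} is such an $A$ with a coassociative coproduct $\Delta:A\to A\otimes A$ satisfying, for each of the two products $*\in\{\cdot,\circ\}$, $$\Delta(x*y)=x_{(1)}\otimes (x_{(2)}*y)+(x*y_{(1)})\otimes y_{(2)}+x\otimes y ;$$ its primitive elements are $\mathrm{Prim}(A)=\ker\Delta$. An \emph{$\mathcal N$-algebra} is a vector space with multilinear $n$-ary operations $N_n$, $n\ge 2$, such that (1) for $n\ge 2$: $\;N_n(x_1,\dots,x_{n-1},N_2(x_n,x_{n+1}))=\sum_{i=1}^{n-1}N_{i+1}(x_1,\dots,x_{i-1},N_{n-i+1}(x_i,\dots,x_n),x_{n+1})$; (2) for $n\ge 3$: $\;N_2(x_1,N_n(x_2,\dots,x_{n+1}))=N_n(N_2(x_1,x_2),x_3,\dots,x_{n+1})-\sum_{i=3}^{n}N_i(x_1,N_{n+2-i}(x_2,\dots,x_{n+3-i}),x_{n+4-i},\dots,x_{n+1})$; (3) for $n,r\ge 3$: $$\begin{aligned}N_n(x,y_1,\dots,y_{n-2},N_r(z,t_1,\dots,t_{r-2},w))&=N_r(N_n(x,y_1,\dots,y_{n-2},z),t_1,\dots,t_{r-2},w)\\&+\sum_{i=1}^{n-2}N_{r+i}(x,y_1,\dots,y_{i-1},N_{n-i}(y_i,\dots,y_{n-2},z),t_1,\dots,t_{r-2},w)\\&-\sum_{i=1}^{r-2}N_{n+r-i-1}(x,y_1,\dots,y_{n-2},N_{i+1}(z,t_1,\dots,t_i),t_{i+1},\dots,t_{r-2},w).\end{aligned}$$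 On a compatible associative algebra put $N_n(x_1,\dots,x_n)=(x_1\cdots x_{n-1})\circ x_n-x_1\cdot((x_2\cdots x_{n-1})\circ x_n)$, where $x_1\cdots x_{n-1}$ is the product for $\cdot$; for $n=2$ this is read as $N_2(x,y)=x\circ y-x\cdot y$. Let $V$ be a vector space over $\mathbb K$ with basis $X$. Let $H_V=\mathrm{As}^2(V)$ be the vector space spanned by the planar rooted trees with at least one non-root vertex, whose non-root vertices are coloured by $X$; the degree of a tree is its number of non-root vertices, and $a\in X$ is identified with the tree of degree one coloured by $a$. The product $t\cdot w$ identifies the roots of $t$ and $w$ ($t$ on the left). For $a\in X$, $t\circ a$ is obtained from $t$ by replacing its root by a vertex coloured $a$ and adding a new root below. In general $t\circ w$ is given by $t\circ(u\circ a)=(t\circ u)\circ a$ and, if $w=w^1\cdots w^m$ with $m\ge 2$ and each $w^i$ a tree whose root has a single child, $$t\circ w=\sum_{i=1}^m((t\cdot w^1\cdots w^{i-1})\circ w^i)\cdot w^{i+1}\cdots w^m-\sum_{i=2}^m t\cdot((w^1\cdots w^{i-1})\circ w^i)\cdot w^{i+1}\cdots w^m .$$ The coproduct is given by $\Delta(a)=0$,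 $\Delta(t\circ a)=t_{(1)}\otimes(t_{(2)}\circ a)+t\otimes a$ and $\Delta(t\cdot w)=t_{(1)}\otimes(t_{(2)}\cdot w)+(t\cdot w_{(1)})\otimes w_{(2)}+t\otimes w$. Then $(H_V,\cdot,\circ)$, with the inclusion $V\to H_V$, is the free compatible associative algebra on $V$, $(H_V,\cdot,\circ,\Delta)$ is a compatible infinitesimal bialgebra, and $\mathrm{Prim}(H_V)$ contains $V$, is stable under all the operations $N_n$, $n\ge 2$, of $H_V$, and with these operations and the inclusion $V\to\mathrm{Prim}(H_V)$ is the free $\mathcal N$-algebra on $V$: it is an $\mathcal N$-algebra, and every linear map from $V$ to an $\mathcal N$-algebra $B$ extends uniquely to a homomorphism of $\mathcal N$-algebras $\mathrm{Prim}(H_V)\to B$. -/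

import Mathlib

open scoped TensorProduct

noncomputable section

namespace CompatAlg

universe u v w

/-! ### Compatible associative algebras and compatible infinitesimal bialgebras -/

section Algebra

variable {K : Type u} [Field K] {A : Type v} [AddCommGroup A] [Module K A]

/-- Associativity of a (bilinear) product. -/
def IsAssoc (m : A →ₗ[K] A →ₗ[K] A) : Prop :=
  ∀ x y z : A, m (m x y) z = m x (m y z)

/-- `(A, dot, circ)` is a compatible associative algebra: both products and their sum
are associative. -/
structure IsCompatible (dot circ : A →ₗ[K] A →ₗ[K] A) : Prop where
  assoc_dot : IsAssoc dot
  assoc_circ : IsAssoc circ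
  assoc_sum : IsAssoc (dot + circ)

/-- Coassociativity of a coproduct. -/
def IsCoassoc (Δ : A →ₗ[K] A ⊗[K] A) : Prop :=
  ∀ x : A, TensorProduct.assoc K A A A (Δ.rTensor A (Δ x)) = Δ.lTensor A (Δ x)

/-- The (non-unitary form of the) unital infinitesimal relation
`Δ(xy) = x₍₁₎ ⊗ x₍₂₎ y + x y₍₁₎ ⊗ y₍₂₎ + x ⊗ y`. -/
def IsInfinitesimal (m : A →ₗ[K] A →ₗ[K] A) (Δ : A →ₗ[K] A ⊗[K] A) : Prop :=
  ∀ x y : A, Δ (m x y) =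
    (m.flip y).lTensor A (Δ x) + (m x).rTensor A (Δ y) + x ⊗ₜ[K] y

/-- `(A, dot, circ, Δ)` is a compatible infinitesimal bialgebra. -/
structure IsCompatibleInfBialgebra (dot circ : A →ₗ[K] A →ₗ[K] A)
    (Δ : A →ₗ[K] A ⊗[K] A) : Prop where
  compatible : IsCompatible dot circ
  coassoc : IsCoassoc Δ
  infinitesimal_dot : IsInfinitesimal dot Δ
  infinitesimal_circ : IsInfinitesimal circ Δ

/-- The subspace of primitive elements: those `x` with `Δ x = 0`. -/
def primitives (Δ : A →ₗ[K] A ⊗[K] A) : Submodule K A := LinearMap.ker Δ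

/-- `(A, dot, circ)` with the linear map `ι : V → A` is the free compatible associative
algebra on `V`. -/
def IsFreeCompatible {V : Type*} [AddCommGroup V] [Module K V]
    (dot circ : A →ₗ[K] A →ₗ[K] A) (ι : V →ₗ[K] A) : Prop :=
  IsCompatible dot circ ∧
  ∀ (B : Type w) [AddCommGroup B] [Module K B] (dot' circ' : B →ₗ[K] B →ₗ[K] B),
    IsCompatible dot' circ' → ∀ f : V →ₗ[K] B,
      ∃! g : A →ₗ[K] B,
        (∀ x y, g (dot x y) = dot' (g x) (g y)) ∧
        (∀ x y, g (circ x y) = circ' (g x) (g y)) ∧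
        ∀ v, g (ι v) = f v

/-! ### `N`-algebras -/

/-- `A` with the operations `N` is an `𝒩`-algebra.  The family of operations
`N_n : A^{⊗ n} → A`, `n ≥ 2`, is encoded by one function on lists:
`N_n(x₁, …, x_n) = N [x₁, …, x_n]`.  The values of `N` on lists of length `< 2` play no role. -/
structure IsNAlgebra (K : Type u) [Field K] {A : Type v} [AddCommGroup A] [Module K A]
    (N : List A → A) : Prop where
  /-- Each `N_n`, `n ≥ 2`, is linear in each of its arguments. -/
  multilinear : ∀ l r : List A, 1 ≤ l.length + r.length →
    IsLinearMap K (fun x : A => N (l ++ x :: r))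
  /-- With `l = [x₁, …, x_{n-1}]`, `x = x_n`, `y = x_{n+1}`, `n ≥ 2`:
  `N_n(x₁, …, x_{n-1}, N₂(x_n, x_{n+1}))
    = ∑_{i=1}^{n-1} N_{i+1}(x₁, …, x_{i-1}, N_{n-i+1}(x_i, …, x_n), x_{n+1})`;
  the summation index is `j = i - 1`. -/
  rel₁ : ∀ (l : List A) (x y : A), 1 ≤ l.length →
    N (l ++ [N [x, y]]) =
      ∑ j ∈ Finset.range l.length, N (l.take j ++ [N (l.drop j ++ [x]), y])
  /-- With `x = x₁`, `y = x₂`, `l = [x₃, …, x_n]`, `z = x_{n+1}`, `n ≥ 3`: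
  `N₂(x₁, N_n(x₂, …, x_{n+1})) = N_n(N₂(x₁, x₂), x₃, …, x_{n+1})
    - ∑_{i=3}^{n} N_i(x₁, N_{n+2-i}(x₂, …, x_{n+3-i}), x_{n+4-i}, …, x_{n+1})`;
  the summation index is `k = n + 1 - i`. -/
  rel₂ : ∀ (x y : A) (l : List A) (z : A), 1 ≤ l.length →
    N [x, N (y :: l ++ [z])] =
      N (N [x, y] :: l ++ [z]) -
        ∑ k ∈ Finset.Icc 1 l.length, N (x :: N (y :: l.take k) :: l.drop k ++ [z])
  /-- With `ys = [y₁, …, y_{n-2}]`, `ts = [t₁, …, t_{r-2}]`, `n, r ≥ 3`: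
  `N_n(x, y₁, …, y_{n-2}, N_r(z, t₁, …, t_{r-2}, w))
    = N_r(N_n(x, y₁, …, y_{n-2}, z), t₁, …, t_{r-2}, w)
    + ∑_{i=1}^{n-2} N_{r+i}(x, y₁, …, y_{i-1}, N_{n-i}(y_i, …, y_{n-2}, z), t₁, …, t_{r-2}, w)
    - ∑_{i=1}^{r-2} N_{n+r-i-1}(x, y₁, …, y_{n-2}, N_{i+1}(z, t₁, …, t_i), t_{i+1}, …, t_{r-2}, w)`;
  the index of the first sum is `j = i - 1`. -/
  rel₃ : ∀ (x : A) (ys : List A) (z : A) (ts : List A) (w : A),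
    1 ≤ ys.length → 1 ≤ ts.length →
    N (x :: ys ++ [N (z :: ts ++ [w])]) =
      N (N (x :: ys ++ [z]) :: ts ++ [w])
      + ∑ j ∈ Finset.range ys.length,
          N (x :: ys.take j ++ N (ys.drop j ++ [z]) :: ts ++ [w])
      - ∑ i ∈ Finset.Icc 1 ts.length,
          N (x :: ys ++ N (z :: ts.take i) :: ts.drop i ++ [w])

/-- `A` with the operations `N` and the linear map `ι : V → A` is the free `𝒩`-algebra
on `V`. -/
def IsFreeNAlgebra {V : Type*} [AddCommGroup V] [Module K V]
    (N : List A → A) (ι : V →ₗ[K] A) : Prop :=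
  IsNAlgebra K N ∧
  ∀ (B : Type w) [AddCommGroup B] [Module K B] (N' : List B → B),
    IsNAlgebra K N' → ∀ f : V →ₗ[K] B,
      ∃! g : A →ₗ[K] B,
        (∀ l : List A, 2 ≤ l.length → g (N l) = N' (l.map g)) ∧ ∀ v, g (ι v) = f v

/-- The product `x₁ · x₂ · … · x_k` of the nonempty list `x₁ :: [x₂, …, x_k]`. -/
def dotProd (dot : A →ₗ[K] A →ₗ[K] A) : A → List A → A
  | x, [] => x
  | x, y :: l => dot x (dotProd dot y l)

/-- `(x₁ · … · x_k) ∘ z`, read as `z` when `k = 0`. -/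
def prodCirc (dot circ : A →ₗ[K] A →ₗ[K] A) : List A → A → A
  | [], z => z
  | x :: l, z => circ (dotProd dot x l) z

/-- The operations `N_n`, `n ≥ 2`, of a compatible associative algebra:
`N_n(x₁, …, x_n) = (x₁ · … · x_{n-1}) ∘ x_n - x₁ · ((x₂ · … · x_{n-1}) ∘ x_n)`,
in particular `N₂(x, y) = x ∘ y - x · y`.  (Lists of length `< 2` get the value `0`.) -/
def nOp (dot circ : A →ₗ[K] A →ₗ[K] A) : List A → A
  | x :: y :: l =>
      prodCirc dot circ (x :: (y :: l).dropLast) ((y :: l).getLast (List.cons_ne_nil y l)) -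
        dot x (prodCirc dot circ (y :: l).dropLast ((y :: l).getLast (List.cons_ne_nil y l)))
  | _ => 0

end Algebra

/-! ### The algebra of planar rooted trees -/

/-- Planar rooted trees with at least one vertex besides the root, whose vertices other than
the root are coloured by `X` (the root carries no colour).  Such a tree is of exactly one of
four forms, according to whether the root has one child or more, and whether the leftmost child
`a` of the root is a leaf or carries a tree `t` (that is, `a` takes the place of the root
of `t`). -/
inductive PTree (X : Type u) : Type u
  /-- the root has one child, the leaf `a` -/
  | leaf (a : X) : PTree X
  /-- the root has one child `a`, and the part of the tree above `a` is `t` -/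
  | graft (t : PTree X) (a : X) : PTree X
  /-- the leftmost child of the root is the leaf `a`; the remaining part of the tree is `w` -/
  | leafCons (a : X) (w : PTree X) : PTree X
  /-- the leftmost child of the root is `a`, carrying `t`; the remaining part of the tree
  is `w` -/
  | graftCons (t : PTree X) (a : X) (w : PTree X) : PTree X

/-- Identify the roots of two trees, the first one to the left of the second one. -/
def PTree.merge {X : Type u} : PTree X → PTree X → PTree X
  | .leaf a, s => .leafCons a s
  | .graft t a, s => .graftCons t a s
  | .leafCons a w, s => .leafCons a (w.merge s)
  | .graftCons t a w, s => .graftCons t a (w.merge s)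

section Trees

variable (K : Type u) [Field K] (X : Type v)

/-- The vector space spanned by the planar rooted trees with vertices coloured by `X`. -/
abbrev TreeAlg : Type (max u v) := PTree X →₀ K

variable {X}

/-- A tree as a basis element. -/
def tr (t : PTree X) : TreeAlg K X := Finsupp.single t 1

/-- The linear extension of `t ↦ t ∘ a`: `a` takes the place of the root of `t`, and a new
root is added below. -/
def graftLin (a : X) : TreeAlg K X →ₗ[K] TreeAlg K X :=
  Finsupp.linearCombination K (fun t => tr K (PTree.graft t a))

variable (X) in
/-- The product `·`: identification of the roots. -/
def treeDot : TreeAlg K X →ₗ[K] TreeAlg K X →ₗ[K] TreeAlg K X :=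
  Finsupp.linearCombination K (fun t => Finsupp.linearCombination K (fun s => tr K (t.merge s)))

/-- The product `∘` on trees; `circTree K w t` is `t ∘ w`, by recursion on `w`:
`t ∘ a` is grafting, `t ∘ (u ∘ a) = (t ∘ u) ∘ a`, and, for `w = w¹ · w'` with `w¹` irreducible,
`t ∘ w = (t ∘ w¹) · w' + (t · w¹) ∘ w' - t · (w¹ ∘ w')`.
Unfolded along `w = w¹ · … · w^m` the last rule reads
`t ∘ w = ∑_{i=1}^{m} ((t · w¹ · … · w^{i-1}) ∘ w^i) · w^{i+1} · … · w^m
  - ∑_{i=2}^{m} t · ((w¹ · … · w^{i-1}) ∘ w^i) · w^{i+1} · … · w^m`. -/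
def circTree : PTree X → PTree X → TreeAlg K X
  | .leaf a, t => tr K (.graft t a)
  | .graft u a, t => graftLin K a (circTree u t)
  | .leafCons a w, t =>
      treeDot K X (tr K (.graft t a)) (tr K w)
        + circTree w (t.merge (.leaf a))
        - treeDot K X (tr K t) (circTree w (.leaf a))
  | .graftCons u a w, t =>
      treeDot K X (graftLin K a (circTree u t)) (tr K w)
        + circTree w (t.merge (.graft u a))
        - treeDot K X (tr K t) (circTree w (.graft u a))

variable (X) in
/-- The product `∘`, extended bilinearly. -/
def treeCirc : TreeAlg K X →ₗ[K] TreeAlg K X →ₗ[K] TreeAlg K X :=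
  Finsupp.linearCombination K (fun t => Finsupp.linearCombination K (fun w => circTree K w t))

/-- `Δ(t ∘ a) = t₍₁₎ ⊗ (t₍₂₎ ∘ a) + t ⊗ a` in terms of `t` and `d = Δ(t)`. -/
def comulGraft (d : TreeAlg K X ⊗[K] TreeAlg K X) (t : PTree X) (a : X) :
    TreeAlg K X ⊗[K] TreeAlg K X :=
  (graftLin K a).lTensor (TreeAlg K X) d + tr K t ⊗ₜ[K] tr K (.leaf a)

/-- The coproduct on trees: `Δ(a) = 0`, `Δ(t ∘ a) = t₍₁₎ ⊗ (t₍₂₎ ∘ a) + t ⊗ a` and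
`Δ(t · w) = t₍₁₎ ⊗ (t₍₂₎ · w) + (t · w₍₁₎) ⊗ w₍₂₎ + t ⊗ w` (for `t` irreducible). -/
def comulTree : PTree X → TreeAlg K X ⊗[K] TreeAlg K X
  | .leaf _ => 0
  | .graft t a => comulGraft K (comulTree t) t a
  | .leafCons a w =>
      (treeDot K X (tr K (.leaf a))).rTensor (TreeAlg K X) (comulTree w)
        + tr K (.leaf a) ⊗ₜ[K] tr K w
  | .graftCons t a w =>
      ((treeDot K X).flip (tr K w)).lTensor (TreeAlg K X) (comulGraft K (comulTree t) t a)
        + (treeDot K X (tr K (.graft t a))).rTensor (TreeAlg K X) (comulTree w)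
        + tr K (.graft t a) ⊗ₜ[K] tr K w

variable (X) in
/-- The coproduct `Δ`, extended linearly. -/
def treeComul : TreeAlg K X →ₗ[K] TreeAlg K X ⊗[K] TreeAlg K X :=
  Finsupp.linearCombination K (comulTree K)

/-- The inclusion `V → As²(V)` for a vector space `V` with basis `b`: the basis vector `b a` is
sent to the tree of degree one coloured by `a`. -/
def treeIncl {K : Type u} [Field K] {X : Type v} {V : Type*} [AddCommGroup V] [Module K V]
    (b : Module.Basis X K V) : V →ₗ[K] TreeAlg K X :=
  b.constr K (fun a => tr K (.leaf a))

end Trees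

end CompatAlg

end

/-!
Everything rests on the difference `x ⋆ y = x ∘ y - x · y` of the two products. Every linear
combination of compatible products is associative and compatible with the others, so a compatible
associative algebra may be given by `·` and `⋆`, and `N_n(x₁, …, x_n)` is
`(x₁ ⋯ x_{n-1}) ⋆ x_n - x₁ · ((x₂ ⋯ x_{n-1}) ⋆ x_n)`. By induction,
`(x₁ ⋯ x_k) ⋆ (y₁ ⋯ y_m)` is the sum of the `u · N(v, p) · q` over all factorizations `x = u · v`
and `y = p · q` with `v` and `p` nonempty.

*Trees.* The definition of `∘` on trees states compatibility with an irreducible tree in the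
middle, and associativity with a generator on the right. Both conditions propagate to products,
because of the cocycle identities for associators (`mixed_mul_middle`, `assoc_mul_right`), and so
do the infinitesimal relations and coassociativity. Freeness is then a recursion on trees.

*Relations.* The three families of relations of an `𝒩`-algebra are one relation `MiddleRel` with a
single element in the middle. In a compatible algebra with unit, the associator of `⋆` with a
single element in the middle is a combination of instances of `MiddleRel`
(`IsStar.associator`). Hence associativity of `⋆` implies these relations
(`IsStar.middleRel_of_assoc`), and conversely (`IsStar.assoc_of_middleRel`). The first direction,
after adjunction of a unit, shows that primitive elements form an `𝒩`-algebra.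

*Enveloping algebra.* For an `𝒩`-algebra `B`, the second direction makes the tensor algebra of `B`
a compatible associative algebra whose operations restrict to those of `B`. The deconcatenation
coproduct is infinitesimal for both products, and its primitive elements are those of `B`
(`eq_ι_of_envComul_eq_zero`). A map `V → B` extends to a homomorphism from the trees to the
enveloping algebra, which preserves coproducts and therefore maps primitive elements to `B`
(`exists_primHom`). This is the required extension.

*Uniqueness.* One has to see that an `𝒩`-subalgebra `P` of the primitive elements which contains
`V` is everything (`prim_generated`). Let `F` be the homomorphism from the trees to the enveloping
algebra of all primitive elements. The products of those elements of `P` which `F` fixes span the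
algebra of trees. On such products `F` followed by multiplication is the identity and the part of
degree one of `F` lies in `P`; a primitive element is its own part of degree one, hence lies
in `P`.
-/

noncomputable section

namespace CompatAlg

/-! ### Pairs of bilinear products -/

section Products

variable {K : Type*} [Field K] {A : Type*} [AddCommGroup A] [Module K A]

/-- The compatibility condition of two products, that is, the mixed part of the associativity
of their sum. -/
def IsMixed (d c : A →ₗ[K] A →ₗ[K] A) : Prop :=
  ∀ x y z : A, c (d x y) z + d (c x y) z = d x (c y z) + c x (d y z)

variable {d c : A →ₗ[K] A →ₗ[K] A}

lemma isCompatible_iff : IsCompatible d c ↔ IsAssoc d ∧ IsAssoc c ∧ IsMixed d c := by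
  constructor
  · rintro ⟨hd, hc, hs⟩
    refine ⟨hd, hc, fun x y z => ?_⟩
    have h := hs x y z
    simp only [LinearMap.add_apply, map_add, hd x y z, hc x y z] at h
    linear_combination (norm := abel) h
  · rintro ⟨hd, hc, hm⟩
    refine ⟨hd, hc, fun x y z => ?_⟩
    have h := hm x y z
    simp only [LinearMap.add_apply, map_add, hd x y z, hc x y z]
    linear_combination (norm := abel) h

/-- Every linear combination of two compatible products is associative and compatible with
either of them; this is the case of the difference. -/
lemma IsCompatible.sub (h : IsCompatible d c) : IsCompatible d (c - d) := by
  obtain ⟨hd, hc, hm⟩ := isCompatible_iff.1 h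
  refine isCompatible_iff.2 ⟨hd, fun x y z => ?_, fun x y z => ?_⟩
  all_goals
    have h := hm x y z
    simp only [LinearMap.sub_apply, map_sub, hd x y z, hc x y z]
  · linear_combination (norm := abel) -h
  · linear_combination (norm := abel) h

lemma IsCompatible.add (h : IsCompatible d c) : IsCompatible d (d + c) := by
  obtain ⟨hd, -, hm⟩ := isCompatible_iff.1 h
  refine isCompatible_iff.2 ⟨hd, h.assoc_sum, fun x y z => ?_⟩
  have h := hm x y z
  simp only [LinearMap.add_apply, map_add, hd x y z]
  linear_combination (norm := abel) h

/-- For an associative product `d`, the defect of compatibility of `c` is a Hochschild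
coboundary, hence a cocycle; so its vanishing propagates to products in the middle argument. -/
lemma mixed_mul_middle (hd : IsAssoc d) {y y' : A}
    (hy : ∀ x z, c (d x y) z + d (c x y) z = d x (c y z) + c x (d y z))
    (hy' : ∀ x z, c (d x y') z + d (c x y') z = d x (c y' z) + c x (d y' z)) (x z : A) :
    c (d x (d y y')) z + d (c x (d y y')) z = d x (c (d y y') z) + c x (d (d y y') z) := by
  have h1 := congrArg (d x) (hy' y z)
  have h2 := hy' (d x y) z
  have h3 := hy x (d y' z)
  have h4 := congrArg (fun t => d t z) (hy x y')
  simp only [map_add, LinearMap.add_apply, hd _ _ _] at h1 h2 h3 h4 ⊢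
  linear_combination (norm := abel) h2 + h3 - h1 - h4

/-- Associativity of `c` propagates to `d`-products in the middle argument, by the part of degree
two in `λ` of the pentagon identity for the associator of `d + λ c`. -/
lemma assoc_mul_middle (hm : IsMixed d c) {y y' : A}
    (hy : ∀ x z, c (c x y) z = c x (c y z)) (hy' : ∀ x z, c (c x y') z = c x (c y' z))
    (x z : A) : c (c x (d y y')) z = c x (c (d y y') z) := by
  have h1 := congrArg (fun t => c t z) (hm x y y')
  have h2 := congrArg (c x) (hm y y' z)
  have h3 := hm (c x y) y' z
  have h4 := hm x (c y y') z
  have h5 := hm x y (c y' z)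
  have h6 := congrArg (d x) (hy y' z)
  have h7 := congrArg (fun t => d t z) (hy x y')
  simp only [map_add, LinearMap.add_apply, hy, hy'] at h1 h2 h3 h4 h5 h6 h7 ⊢
  linear_combination (norm := abel) h3 - h4 + h5 - h1 - h2

/-- Associativity of `c` propagates to `d`-products in the last argument, by the same identity. -/
lemma assoc_mul_right (hm : IsMixed d c) {z z' : A}
    (hz : ∀ x y, c (c x y) z = c x (c y z)) (hz' : ∀ x y, c (c x y) z' = c x (c y z'))
    (x y : A) : c (c x y) (d z z') = c x (c y (d z z')) := by
  have h1 := hm (c x y) z z'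
  have h2 := congrArg (c x) (hm y z z')
  have h3 := hm x (c y z) z'
  have h4 := congrArg (fun t => c t z') (hm x y z)
  have h5 := hm x y (c z z')
  simp only [map_add, LinearMap.add_apply, hz, hz'] at h1 h2 h3 h4 h5 ⊢
  linear_combination (norm := abel) h2 - h1 + h3 + h4 - h5

end Products

/-! ### The compatible associative algebra of trees -/

section Trees

variable {K : Type*} [Field K] {X : Type*}

@[simp] lemma treeDot_tr (t s : PTree X) : treeDot K X (tr K t) (tr K s) = tr K (t.merge s) := by
  simp [treeDot, tr]

@[simp] lemma treeCirc_tr (t s : PTree X) : treeCirc K X (tr K t) (tr K s) = circTree K s t := by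
  simp [treeCirc, tr]

@[simp] lemma graftLin_tr (t : PTree X) (a : X) : graftLin K a (tr K t) = tr K (.graft t a) := by
  simp [graftLin, tr]

lemma treeAlg_induction {p : TreeAlg K X → Prop} (h0 : p 0) (hadd : ∀ x y, p x → p y → p (x + y))
    (hsmul : ∀ (k : K) x, p x → p (k • x)) (htr : ∀ t, p (tr K t)) (x : TreeAlg K X) : p x := by
  induction x using Finsupp.induction_linear with
  | zero => exact h0
  | add x y hx hy => exact hadd x y hx hy
  | single t k =>
    have : (Finsupp.single t k : TreeAlg K X) = k • tr K t := by simp [tr]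
    exact this ▸ hsmul k _ (htr t)

lemma treeAlg_ext {M : Type*} [AddCommGroup M] [Module K M] {f g : TreeAlg K X →ₗ[K] M}
    (h : ∀ t, f (tr K t) = g (tr K t)) : f = g :=
  Finsupp.lhom_ext' fun t => LinearMap.ext_ring (h t)

lemma treeCirc_leaf (x : TreeAlg K X) (a : X) :
    treeCirc K X x (tr K (.leaf a)) = graftLin K a x := by
  have : (treeCirc K X).flip (tr K (.leaf a)) = graftLin K a :=
    treeAlg_ext fun t => by simp [circTree]
  exact LinearMap.congr_fun this x

/-- The trees of degree one generate `TreeAlg K X` under the product `·` and the maps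
`x ↦ x ∘ a`. -/
lemma treeAlg_generated (S : Submodule K (TreeAlg K X)) (hleaf : ∀ a, tr K (.leaf a) ∈ S)
    (hdot : ∀ x ∈ S, ∀ y ∈ S, treeDot K X x y ∈ S)
    (hcirc : ∀ x ∈ S, ∀ a, treeCirc K X x (tr K (.leaf a)) ∈ S) (x : TreeAlg K X) : x ∈ S := by
  refine treeAlg_induction S.zero_mem (fun _ _ => S.add_mem) (fun k _ => S.smul_mem k)
    (fun t => ?_) x
  have hg (t : PTree X) (a : X) (h : tr K t ∈ S) : tr K (.graft t a) ∈ S := by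
    simpa [circTree] using hcirc _ h a
  induction t with
  | leaf a => exact hleaf a
  | graft t a ih => exact hg t a ih
  | leafCons a w ih => simpa [PTree.merge] using hdot _ (hleaf a) _ ih
  | graftCons t a w ih ih' => simpa [PTree.merge] using hdot _ (hg t a ih) _ ih'

lemma PTree.merge_assoc (t s r : PTree X) : (t.merge s).merge r = t.merge (s.merge r) := by
  induction t <;> simp_all [PTree.merge]

lemma treeDot_assoc : IsAssoc (treeDot K X) := by
  intro x y z
  induction x using treeAlg_induction with
  | h0 => simp
  | hadd x y hx hy => simp [hx, hy]
  | hsmul k x hx => simp [hx]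
  | htr t =>
  induction y using treeAlg_induction with
  | h0 => simp
  | hadd x y hx hy => simp [hx, hy]
  | hsmul k x hx => simp [hx]
  | htr s =>
  induction z using treeAlg_induction with
  | h0 => simp
  | hadd x y hx hy => simp only [map_add, hx, hy]
  | hsmul k x hx => simp only [map_smul, hx]
  | htr r => simp [PTree.merge_assoc]

/-- The defining recursion of `∘` is the compatibility condition with an irreducible tree in
the middle. -/
lemma circTree_merge {s : PTree X} (hs : (∃ a, s = .leaf a) ∨ ∃ u a, s = .graft u a)
    (w t : PTree X) :
    circTree K (s.merge w) t = treeDot K X (circTree K s t) (tr K w) + circTree K w (t.merge s)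
      - treeDot K X (tr K t) (circTree K w s) := by
  rcases hs with ⟨a, rfl⟩ | ⟨u, a, rfl⟩ <;> simp [PTree.merge, circTree]

lemma treeMixed : IsMixed (treeDot K X) (treeCirc K X) := by
  intro x y
  -- the middle factor is first an irreducible tree, then any tree
  have irr {s : PTree X} (hs : (∃ a, s = .leaf a) ∨ ∃ u a, s = .graft u a)
      (x z : TreeAlg K X) : treeCirc K X (treeDot K X x (tr K s)) z
        + treeDot K X (treeCirc K X x (tr K s)) z
      = treeDot K X x (treeCirc K X (tr K s) z) + treeCirc K X x (treeDot K X (tr K s) z) := by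
    induction x using treeAlg_induction with
    | h0 => simp
    | hadd x y hx hy =>
      simp only [map_add, LinearMap.add_apply]
      linear_combination (norm := abel) hx + hy
    | hsmul k x hx =>
      simp only [map_smul, LinearMap.smul_apply, ← smul_add, hx]
    | htr t =>
    induction z using treeAlg_induction with
    | h0 => simp
    | hadd x y hx hy =>
      simp only [map_add]
      linear_combination (norm := abel) hx + hy
    | hsmul k x hx =>
      simp only [map_smul, ← smul_add, hx]
    | htr w =>
      simp only [treeDot_tr, treeCirc_tr, circTree_merge hs]
      abel
  revert x
  induction y using treeAlg_induction with
  | h0 => simp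
  | hadd y y' hy hy' =>
    intro x z
    simp only [map_add, LinearMap.add_apply]
    linear_combination (norm := abel) hy x z + hy' x z
  | hsmul k y hy =>
    intro x z
    simp only [map_smul, LinearMap.smul_apply, ← smul_add, hy]
  | htr t =>
    induction t with
    | leaf a => exact irr (.inl ⟨a, rfl⟩)
    | graft t a => exact irr (.inr ⟨t, a, rfl⟩)
    | leafCons a w ih =>
      have := mixed_mul_middle treeDot_assoc (irr (.inl ⟨a, rfl⟩)) ih
      simpa [PTree.merge] using this
    | graftCons t a w _ ih =>
      have := mixed_mul_middle treeDot_assoc (irr (.inr ⟨t, a, rfl⟩)) ih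
      simpa [PTree.merge] using this

lemma treeCirc_assoc : IsAssoc (treeCirc K X) := by
  let S : Submodule K (TreeAlg K X) :=
    { carrier := {z | ∀ x y, treeCirc K X (treeCirc K X x y) z
        = treeCirc K X x (treeCirc K X y z)}
      zero_mem' := by simp
      add_mem' := fun h h' x y => by simp [h x y, h' x y]
      smul_mem' := fun k z h x y => by simp [h x y] }
  have hleaf (a : X) : tr K (.leaf a) ∈ S := by
    intro x y
    simp only [treeCirc_leaf]
    induction y using treeAlg_induction with
    | h0 => simp
    | hadd x y hx hy => simp [hx, hy]
    | hsmul k x hx => simp [hx]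
    | htr s =>
    induction x using treeAlg_induction with
    | h0 => simp
    | hadd x y hx hy => simp_all
    | hsmul k x hx => simp_all
    | htr t => simp [circTree]
  intro x y z
  refine treeAlg_generated S hleaf (fun z hz z' hz' => assoc_mul_right treeMixed hz hz')
    (fun z hz a x y => ?_) z x y
  rw [← hleaf a, hz, hleaf a, hleaf a]

theorem treeAlg_isCompatible : IsCompatible (treeDot K X) (treeCirc K X) :=
  isCompatible_iff.2 ⟨treeDot_assoc, treeCirc_assoc, treeMixed⟩

/-- The homomorphism from the trees to a compatible associative algebra `(B, d, c)` which maps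
the tree of degree one coloured by `a` to `f a`. -/
def evalTree {B : Type*} [AddCommGroup B] [Module K B] (d c : B →ₗ[K] B →ₗ[K] B) (f : X → B) :
    PTree X → B
  | .leaf a => f a
  | .graft t a => c (evalTree d c f t) (f a)
  | .leafCons a w => d (f a) (evalTree d c f w)
  | .graftCons t a w => d (c (evalTree d c f t) (f a)) (evalTree d c f w)

theorem treeAlg_isFree {V : Type*} [AddCommGroup V] [Module K V] (b : Module.Basis X K V) :
    IsFreeCompatible (treeDot K X) (treeCirc K X) (treeIncl b) := by
  refine ⟨treeAlg_isCompatible, fun B _ _ d c h f => ?_⟩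
  obtain ⟨hd, hc, hm⟩ := isCompatible_iff.1 h
  let e := evalTree d c (fun a => f (b a))
  let g : TreeAlg K X →ₗ[K] B := Finsupp.linearCombination K e
  have hg (t : PTree X) : g (tr K t) = e t := by simp [g, tr]
  have hmerge (t s : PTree X) : e (t.merge s) = d (e t) (e s) := by
    induction t with
    | leaf a => rfl
    | graft t a _ => rfl
    | leafCons a w ih => simp only [PTree.merge, e, evalTree, hd _ _ _] at ih ⊢; rw [ih]
    | graftCons t a w _ ih => simp only [PTree.merge, e, evalTree, hd _ _ _] at ih ⊢; rw [ih]
  have hdot (x y : TreeAlg K X) : g (treeDot K X x y) = d (g x) (g y) := by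
    have : (treeDot K X).compr₂ g = d.compl₁₂ g g :=
      treeAlg_ext fun t => treeAlg_ext fun s => by simp [hg, hmerge]
    simpa using LinearMap.congr_fun₂ this x y
  have hgraft (x : TreeAlg K X) (a : X) : g (graftLin K a x) = c (g x) (f (b a)) := by
    have : g ∘ₗ graftLin K a = c.flip (f (b a)) ∘ₗ g :=
      treeAlg_ext fun t => by simp [hg, e, evalTree]
    exact LinearMap.congr_fun this x
  have hcircTree (w t : PTree X) : g (circTree K w t) = c (e t) (e w) := by
    induction w generalizing t with
    | leaf a => simp [circTree, hg, e, evalTree]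
    | graft u a ih => rw [circTree, hgraft, ih, hc]; rfl
    | leafCons a w ih =>
      have h1 := hm (e t) (f (b a)) (e w)
      simp only [circTree, map_add, map_sub, hdot, ih, hg, hmerge]
      simp only [e, evalTree] at h1 ⊢
      linear_combination (norm := abel) h1
    | graftCons u a w ihu ih =>
      have h1 := hm (e t) (c (e u) (f (b a))) (e w)
      simp only [circTree, map_add, map_sub, hdot, hgraft, ihu, ih, hg, hmerge]
      simp only [e, evalTree, hc _ _ _] at h1 ⊢
      linear_combination (norm := abel) h1
  have hcirc (x y : TreeAlg K X) : g (treeCirc K X x y) = c (g x) (g y) := by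
    have : (treeCirc K X).compr₂ g = c.compl₁₂ g g :=
      treeAlg_ext fun t => treeAlg_ext fun s => by simp [hg, hcircTree]
    simpa using LinearMap.congr_fun₂ this x y
  have hincl (a : X) : treeIncl b (b a) = tr K (.leaf a) := by simp [treeIncl]
  refine ⟨g, ⟨hdot, hcirc, fun v => ?_⟩, ?_⟩
  · have : g ∘ₗ treeIncl b = f := b.ext fun a => by simp [hincl, hg, e, evalTree]
    exact LinearMap.congr_fun this v
  · rintro g' ⟨h1, h2, h3⟩
    have hleaf (a : X) : g' (tr K (.leaf a)) = g (tr K (.leaf a)) := by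
      rw [← hincl, h3, hincl, hg]; rfl
    refine LinearMap.ext fun x => treeAlg_generated (LinearMap.eqLocus g' g) hleaf ?_ ?_ x
    · intro x hx y hy
      rw [LinearMap.mem_eqLocus] at hx hy ⊢
      rw [h1, hdot, hx, hy]
    · intro x hx a
      rw [LinearMap.mem_eqLocus] at hx ⊢
      rw [h2, hcirc, hx, hleaf]

end Trees

/-! ### Infinitesimal coproducts -/

section Coproducts

variable {K : Type*} [Field K] {A : Type*} [AddCommGroup A] [Module K A]
  {d c : A →ₗ[K] A →ₗ[K] A} {Δ : A →ₗ[K] A ⊗[K] A}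

lemma lTensor_rTensor (f g : A →ₗ[K] A) (t : A ⊗[K] A) :
    g.lTensor A (f.rTensor A t) = f.rTensor A (g.lTensor A t) :=
  LinearMap.congr_fun ((LinearMap.lTensor_comp_rTensor A f g).trans
    (LinearMap.rTensor_comp_lTensor A f g).symm) t

/-- The infinitesimal relation propagates to products in the first argument. -/
lemma infinitesimal_mul_left (hd : IsAssoc d) {x x' : A}
    (hx : ∀ y, Δ (d x y) = (d.flip y).lTensor A (Δ x) + (d x).rTensor A (Δ y) + x ⊗ₜ[K] y)
    (hx' : ∀ y, Δ (d x' y) = (d.flip y).lTensor A (Δ x') + (d x').rTensor A (Δ y) + x' ⊗ₜ[K] y)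
    (y : A) : Δ (d (d x x') y) = (d.flip y).lTensor A (Δ (d x x'))
      + (d (d x x')).rTensor A (Δ y) + d x x' ⊗ₜ[K] y := by
  have h1 : d.flip (d x' y) = d.flip y ∘ₗ d.flip x' := LinearMap.ext fun z => (hd z x' y).symm
  have h2 : d (d x x') = d x ∘ₗ d x' := LinearMap.ext fun z => hd x x' z
  rw [hd, hx, hx', hx, h1, h2]
  simp only [map_add, LinearMap.lTensor_comp_apply, LinearMap.rTensor_comp_apply, lTensor_rTensor,
    LinearMap.rTensor_tmul, LinearMap.lTensor_tmul, LinearMap.flip_apply]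
  abel

/-- The infinitesimal relation of `c` propagates to `d`-products in the second argument. -/
lemma infinitesimal_mul_right (hm : IsMixed d c) (hd : IsInfinitesimal d Δ) {y y' : A}
    (hy : ∀ x, Δ (c x y) = (c.flip y).lTensor A (Δ x) + (c x).rTensor A (Δ y) + x ⊗ₜ[K] y)
    (hy' : ∀ x, Δ (c x y') = (c.flip y').lTensor A (Δ x) + (c x).rTensor A (Δ y') + x ⊗ₜ[K] y')
    (x : A) : Δ (c x (d y y')) = (c.flip (d y y')).lTensor A (Δ x)
      + (c x).rTensor A (Δ (d y y')) + x ⊗ₜ[K] d y y' := by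
  have h0 (z : A) : c z (d y y') = c (d z y) y' + d (c z y) y' - d z (c y y') := by
    rw [hm]; abel
  have h1 : c.flip (d y y') =
      c.flip y' ∘ₗ d.flip y + d.flip y' ∘ₗ c.flip y - d.flip (c y y') :=
    LinearMap.ext fun z => h0 z
  have h2 : c x ∘ₗ d y = c (d x y) + d (c x y) - d x ∘ₗ c y := LinearMap.ext fun z => by
    have := hm x y z
    simp only [LinearMap.sub_apply, LinearMap.add_apply, LinearMap.comp_apply]
    rw [this]; abel
  have h3 (t : A ⊗[K] A) : (c x).rTensor A ((d y).rTensor A t) = (c (d x y)).rTensor A t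
      + (d (c x y)).rTensor A t - (d x).rTensor A ((c y).rTensor A t) := by
    simp only [← LinearMap.rTensor_comp_apply, h2, LinearMap.rTensor_sub, LinearMap.rTensor_add,
      LinearMap.sub_apply, LinearMap.add_apply]
  rw [h1, h0]
  simp only [hd _ _, hy, hy', map_add, map_sub, LinearMap.lTensor_sub, LinearMap.lTensor_add,
    LinearMap.sub_apply, LinearMap.add_apply, LinearMap.lTensor_comp_apply, h3, lTensor_rTensor,
    LinearMap.rTensor_tmul, LinearMap.lTensor_tmul, LinearMap.flip_apply]
  abel

/-- The infinitesimal relation of an associative product propagates to products in the second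
argument. -/
lemma infinitesimal_circ_right (hc : IsAssoc c) {y y' : A}
    (hy : ∀ x, Δ (c x y) = (c.flip y).lTensor A (Δ x) + (c x).rTensor A (Δ y) + x ⊗ₜ[K] y)
    (hy' : ∀ x, Δ (c x y') = (c.flip y').lTensor A (Δ x) + (c x).rTensor A (Δ y') + x ⊗ₜ[K] y')
    (x : A) : Δ (c x (c y y')) = (c.flip (c y y')).lTensor A (Δ x)
      + (c x).rTensor A (Δ (c y y')) + x ⊗ₜ[K] c y y' := by
  have h1 : c.flip (c y y') = c.flip y' ∘ₗ c.flip y := LinearMap.ext fun z => (hc z y y').symm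
  have h2 : c (c x y) = c x ∘ₗ c y := LinearMap.ext fun z => hc x y z
  rw [← hc, hy', hy, hy', h1, h2]
  simp only [map_add, LinearMap.lTensor_comp_apply, LinearMap.rTensor_comp_apply, lTensor_rTensor,
    LinearMap.rTensor_tmul, LinearMap.lTensor_tmul, LinearMap.flip_apply]
  abel

/-- Coassociativity propagates to products for which the infinitesimal relation holds. -/
lemma coassoc_mul (hd : IsInfinitesimal d Δ) {x y : A}
    (hx : TensorProduct.assoc K A A A (Δ.rTensor A (Δ x)) = Δ.lTensor A (Δ x))
    (hy : TensorProduct.assoc K A A A (Δ.rTensor A (Δ y)) = Δ.lTensor A (Δ y)) :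
    TensorProduct.assoc K A A A (Δ.rTensor A (Δ (d x y))) = Δ.lTensor A (Δ (d x y)) := by
  -- `mid t (u ⊗ v) = t₍₁₎ ⊗ t₍₂₎ u ⊗ v`
  let mid (s t : A ⊗[K] A) : A ⊗[K] (A ⊗[K] A) :=
    ((LinearMap.rTensorHom A ∘ₗ d).flip s).lTensor A t
  have mid_add (s s' t : A ⊗[K] A) : mid (s + s') t = mid s t + mid s' t := by
    simp only [mid, map_add, LinearMap.lTensor_add, LinearMap.add_apply]
  have h1 (t : A ⊗[K] A) : TensorProduct.assoc K A A A (Δ.rTensor A ((d.flip y).lTensor A t))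
      = ((d.flip y).lTensor A).lTensor A (TensorProduct.assoc K A A A (Δ.rTensor A t)) := by
    induction t with
    | zero => simp
    | add t t' ht ht' => simp only [map_add, ht, ht']
    | tmul u v =>
      simp only [LinearMap.lTensor_tmul, LinearMap.rTensor_tmul]
      induction Δ u with
      | zero => simp
      | add t t' ht ht' => simp only [TensorProduct.add_tmul, map_add, ht, ht']
      | tmul p q => simp
  have h2 (t : A ⊗[K] A) : Δ.lTensor A ((d.flip y).lTensor A t)
      = ((d.flip y).lTensor A).lTensor A (Δ.lTensor A t) + mid (Δ y) t
        + TensorProduct.assoc K A A A (t ⊗ₜ y) := by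
    induction t with
    | zero => simp [mid]
    | add t t' ht ht' =>
      simp only [map_add, ht, ht', TensorProduct.add_tmul, mid]
      abel
    | tmul u v => simp [mid, hd v y, TensorProduct.tmul_add]
  have h3 (s : A ⊗[K] A) : TensorProduct.assoc K A A A (Δ.rTensor A ((d x).rTensor A s))
      = mid s (Δ x) + (d x).rTensor (A ⊗[K] A) (TensorProduct.assoc K A A A (Δ.rTensor A s))
        + x ⊗ₜ s := by
    induction s with
    | zero => simp [mid]
    | add t t' ht ht' =>
      simp only [map_add, ht, ht', TensorProduct.tmul_add, mid_add]
      abel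
    | tmul u v =>
      simp only [LinearMap.rTensor_tmul, hd x u, TensorProduct.add_tmul, map_add,
        TensorProduct.assoc_tmul]
      congr 2
      · induction Δ x with
        | zero => simp [mid]
        | add t t' ht ht' => simp only [TensorProduct.add_tmul, map_add, ht, ht', mid]
        | tmul p q => simp [mid]
      · induction Δ u with
        | zero => simp
        | add t t' ht ht' => simp only [TensorProduct.add_tmul, map_add, ht, ht']
        | tmul p q => simp
  have h4 (s : A ⊗[K] A) : Δ.lTensor A ((d x).rTensor A s)
      = (d x).rTensor (A ⊗[K] A) (Δ.lTensor A s) := by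
    induction s with
    | zero => simp
    | add t t' ht ht' => simp only [map_add, ht, ht']
    | tmul u v => simp
  rw [hd]
  simp only [map_add, h1, h2, h3, h4, hx, hy, LinearMap.rTensor_tmul, LinearMap.lTensor_tmul]
  abel

/-- If `g` is multiplicative for `d` and `d'`, the set where
`g` is compatible with the coproducts is closed under products. -/
lemma map_comul_mul {B : Type*} [AddCommGroup B] [Module K B] {d' : B →ₗ[K] B →ₗ[K] B}
    {Δ' : B →ₗ[K] B ⊗[K] B} (hd : IsInfinitesimal d Δ) (hd' : IsInfinitesimal d' Δ')
    {g : A →ₗ[K] B} (hg : ∀ x y, g (d x y) = d' (g x) (g y)) {x y : A}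
    (hx : TensorProduct.map g g (Δ x) = Δ' (g x)) (hy : TensorProduct.map g g (Δ y) = Δ' (g y)) :
    TensorProduct.map g g (Δ (d x y)) = Δ' (g (d x y)) := by
  have h1 (t : A ⊗[K] A) : TensorProduct.map g g ((d.flip y).lTensor A t)
      = (d'.flip (g y)).lTensor B (TensorProduct.map g g t) := by
    induction t with
    | zero => simp
    | add t t' ht ht' => simp only [map_add, ht, ht']
    | tmul u v => simp [hg]
  have h2 (t : A ⊗[K] A) : TensorProduct.map g g ((d x).rTensor A t)
      = (d' (g x)).rTensor B (TensorProduct.map g g t) := by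
    induction t with
    | zero => simp
    | add t t' ht ht' => simp only [map_add, ht, ht']
    | tmul u v => simp [hg]
  rw [hd, hg, hd']
  simp only [map_add, h1, h2, hx, hy, TensorProduct.map_tmul]

end Coproducts

/-! ### The coproduct of trees -/

section Trees

variable {K : Type*} [Field K] {X : Type*}

@[simp] lemma treeComul_tr (t : PTree X) : treeComul K X (tr K t) = comulTree K t := by
  simp [treeComul, tr]

lemma treeComul_graftLin (x : TreeAlg K X) (a : X) : treeComul K X (graftLin K a x)
    = (graftLin K a).lTensor _ (treeComul K X x) + x ⊗ₜ[K] tr K (.leaf a) := by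
  induction x using treeAlg_induction with
  | h0 => simp
  | hadd x y hx hy =>
    simp only [map_add, hx, hy, TensorProduct.add_tmul]
    abel
  | hsmul k x hx => simp only [map_smul, hx, smul_add, TensorProduct.smul_tmul']
  | htr t => simp [comulTree, comulGraft]

lemma treeComul_infinitesimal_dot : IsInfinitesimal (treeDot K X) (treeComul K X) := by
  have irr {s : PTree X} (hs : (∃ a, s = .leaf a) ∨ ∃ u a, s = .graft u a) (y : TreeAlg K X) :
      treeComul K X (treeDot K X (tr K s) y)
        = ((treeDot K X).flip y).lTensor _ (treeComul K X (tr K s))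
          + (treeDot K X (tr K s)).rTensor _ (treeComul K X y) + tr K s ⊗ₜ[K] y := by
    induction y using treeAlg_induction with
    | h0 => simp
    | hadd x y hx hy =>
      simp only [map_add, hx, hy, TensorProduct.tmul_add, LinearMap.lTensor_add,
        LinearMap.add_apply]
      abel
    | hsmul k x hx =>
      simp only [map_smul, hx, smul_add, TensorProduct.tmul_smul, LinearMap.lTensor_smul,
        LinearMap.smul_apply]
    | htr t =>
      rcases hs with ⟨a, rfl⟩ | ⟨u, a, rfl⟩ <;> simp [PTree.merge, comulTree]
  intro x y
  revert y
  induction x using treeAlg_induction with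
  | h0 => simp
  | hadd x x' hx hx' =>
    intro y
    simp only [map_add, LinearMap.add_apply, hx, hx', TensorProduct.add_tmul,
      LinearMap.rTensor_add]
    abel
  | hsmul k x hx =>
    intro y
    simp only [map_smul, LinearMap.smul_apply, hx, smul_add, TensorProduct.smul_tmul',
      LinearMap.rTensor_smul]
  | htr t =>
    induction t with
    | leaf a => exact irr (.inl ⟨a, rfl⟩)
    | graft t a => exact irr (.inr ⟨t, a, rfl⟩)
    | leafCons a w ih =>
      have := infinitesimal_mul_left treeDot_assoc (irr (.inl ⟨a, rfl⟩)) ih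
      rwa [treeDot_tr] at this
    | graftCons t a w _ ih =>
      have := infinitesimal_mul_left treeDot_assoc (irr (.inr ⟨t, a, rfl⟩)) ih
      rwa [treeDot_tr] at this

lemma treeComul_infinitesimal_circ : IsInfinitesimal (treeCirc K X) (treeComul K X) := by
  let S : Submodule K (TreeAlg K X) :=
    { carrier := {y | ∀ x, treeComul K X (treeCirc K X x y)
        = ((treeCirc K X).flip y).lTensor _ (treeComul K X x)
          + (treeCirc K X x).rTensor _ (treeComul K X y) + x ⊗ₜ[K] y}
      zero_mem' := by simp
      add_mem' := fun h h' x => by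
        simp only [map_add, h x, h' x, TensorProduct.tmul_add, LinearMap.lTensor_add,
          LinearMap.add_apply]
        abel
      smul_mem' := fun k z h x => by
        simp only [map_smul, h x, smul_add, TensorProduct.tmul_smul, LinearMap.lTensor_smul,
          LinearMap.smul_apply] }
  have hleaf (a : X) : tr K (.leaf a) ∈ S := by
    intro x
    have : (treeCirc K X).flip (tr K (.leaf a)) = graftLin K a :=
      LinearMap.ext fun x => treeCirc_leaf x a
    rw [treeCirc_leaf, this, treeComul_graftLin]
    simp [comulTree]
  intro x y
  refine treeAlg_generated S hleaf (fun y hy y' hy' => ?_) (fun y hy a => ?_) y x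
  · exact infinitesimal_mul_right treeMixed treeComul_infinitesimal_dot hy hy'
  · exact infinitesimal_circ_right treeCirc_assoc hy (hleaf a)

theorem treeAlg_isCompatibleInfBialgebra :
    IsCompatibleInfBialgebra (treeDot K X) (treeCirc K X) (treeComul K X) where
  compatible := treeAlg_isCompatible
  infinitesimal_dot := treeComul_infinitesimal_dot
  infinitesimal_circ := treeComul_infinitesimal_circ
  coassoc := by
    let S : Submodule K (TreeAlg K X) := LinearMap.eqLocus
      ((TensorProduct.assoc K _ _ _).toLinearMap ∘ₗ (treeComul K X).rTensor _ ∘ₗ treeComul K X)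
      ((treeComul K X).lTensor _ ∘ₗ treeComul K X)
    have hleaf (a : X) : tr K (.leaf a) ∈ S := by simp [S, comulTree]
    exact treeAlg_generated S hleaf (fun x hx y hy => coassoc_mul treeComul_infinitesimal_dot hx hy)
      (fun x hx a => coassoc_mul treeComul_infinitesimal_circ hx (hleaf a))

end Trees

/-! ### Operations on lists and their relations -/

section Lists

variable {B M : Type*} [AddCommMonoid M]

/-- `sumL N φ l c = ∑ φ(u, N(v, c))` over all `l = u ++ v` with `v` nonempty. -/
def sumL (N : List B → B) (φ : List B → M) (l : List B) (c : B) : M :=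
  ∑ j ∈ Finset.range l.length, φ (l.take j ++ [N (l.drop j ++ [c])])

/-- `sumR N φ c l = ∑ φ(N(c, p), q)` over all `l = p ++ q` with `p` nonempty. -/
def sumR (N : List B → B) (φ : List B → M) (c : B) (l : List B) : M :=
  ∑ k ∈ Finset.range l.length, φ (N (c :: l.take (k + 1)) :: l.drop (k + 1))

variable (N : List B → B) (φ : List B → M)

@[simp] lemma sumL_nil (c : B) : sumL N φ [] c = 0 := rfl

lemma sumL_cons (a : B) (l : List B) (c : B) :
    sumL N φ (a :: l) c = φ [N (a :: l ++ [c])] + sumL N (fun m => φ (a :: m)) l c := by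
  simp [sumL, Finset.sum_range_succ', add_comm]

@[simp] lemma sumR_nil (c : B) : sumR N φ c [] = 0 := rfl

lemma sumR_snoc (c : B) (l : List B) (e : B) :
    sumR N φ c (l ++ [e])
      = sumR N (fun m => φ (m ++ [e])) c l + φ [N (c :: l ++ [e])] := by
  rw [sumR, sumR, List.length_append, List.length_singleton, Finset.sum_range_succ]
  congr 1
  · refine Finset.sum_congr rfl fun k hk => ?_
    have hk : k + 1 ≤ l.length := Finset.mem_range.1 hk
    rw [List.take_append_of_le_length hk, List.drop_append_of_le_length hk, List.cons_append]
  · simp [List.take_of_length_le]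

lemma sum_Icc_one (f : ℕ → M) (n : ℕ) :
    ∑ i ∈ Finset.Icc 1 n, f i = ∑ k ∈ Finset.range n, f (k + 1) := by
  induction n with
  | zero => simp
  | succ n ih => rw [Finset.sum_Icc_succ_top (by omega), ih, Finset.sum_range_succ]

lemma exists_eq_cons_snoc {l : List B} (h : 2 ≤ l.length) : ∃ a m e, l = a :: m ++ [e] := by
  match l, h with
  | a :: b :: l, _ =>
    exact ⟨a, (b :: l).dropLast, (b :: l).getLast (by simp), by
      rw [List.cons_append, List.dropLast_append_getLast]⟩

end Lists

/-- The relations of an `𝒩`-algebra in a uniform form, with a single element `c` in the middle: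
for nonempty lists `x` and `z`, the sum of the `N(u, N(v, c), z)` over `x = u ++ v` with `v`
nonempty is the sum of the `N(x, N(c, p), q)` over `z = p ++ q` with `p` nonempty. -/
def MiddleRel {B : Type*} [AddCommMonoid B] (N : List B → B) : Prop :=
  ∀ (x : List B) (c : B) (z : List B), x ≠ [] → z ≠ [] →
    sumL N (fun m => N (m ++ z)) x c = sumR N (fun m => N (x ++ m)) c z

/-- The three families of relations are the cases of `MiddleRel` in which `z` is a singleton,
`x` is a singleton and `z` is not, and neither is a singleton. -/
lemma isNAlgebra_iff {K : Type*} [Field K] {B : Type*} [AddCommGroup B] [Module K B]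
    {N : List B → B} : IsNAlgebra K N ↔
      (∀ l r : List B, 1 ≤ l.length + r.length → IsLinearMap K (fun x => N (l ++ x :: r)))
        ∧ MiddleRel N := by
  constructor
  · rintro ⟨h, h1, h2, h3⟩
    refine ⟨h, fun x c z hx hz => ?_⟩
    obtain ⟨z, e, rfl⟩ := List.eq_nil_or_concat'  z |>.resolve_left hz
    obtain ⟨a, x, rfl⟩ := List.exists_cons_of_ne_nil hx
    rw [sumR_snoc]
    rcases z with _ | ⟨t, z⟩
    · have := h1 (a :: x) c e (by simp)
      simp only [sumL, sumR_nil, List.nil_append, zero_add, List.cons_append, List.append_assoc]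
        at this ⊢
      exact this.symm
    · rcases x with _ | ⟨y, x⟩
      · have := h2 a c (t :: z) e (by simp)
        rw [sum_Icc_one, eq_sub_iff_add_eq, add_comm] at this
        simpa [sumL, sumR] using this.symm
      · have := h3 a (y :: x) c (t :: z) e (by simp) (by simp)
        rw [sum_Icc_one, eq_sub_iff_add_eq, add_comm] at this
        rw [sumL_cons]
        simpa [sumL, sumR] using this.symm
  · rintro ⟨h, hR⟩
    refine ⟨h, fun l x y hl => ?_, fun x y l z hl => ?_, fun x ys z ts w _ _ => ?_⟩
    · have := hR l x [y] (List.ne_nil_of_length_pos hl) (by simp)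
      simpa [sumL, sumR] using this.symm
    · have := hR [x] y (l ++ [z]) (by simp) (by simp)
      rw [sumR_snoc] at this
      rw [sum_Icc_one, eq_sub_iff_add_eq, add_comm]
      simpa [sumL, sumR] using this.symm
    · have := hR (x :: ys) z (ts ++ [w]) (by simp) (by simp)
      rw [sumR_snoc, sumL_cons] at this
      rw [sum_Icc_one, eq_sub_iff_add_eq, add_comm]
      simpa [sumL, sumR] using this.symm

/-! ### The associator of the second product -/

section Associator

variable {K : Type*} [Field K] {A : Type*} [Ring A] [Algebra K A] {B : Type*} [AddCommGroup B]
  [Module K B]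

/-- The product in `A` of the images under `β` of the members of a list. -/
abbrev listProd (β : B →ₗ[K] A) (l : List B) : A := (l.map β).prod

/-- A product `star` on the unital algebra `A` which is compatible with the multiplication,
vanishes on the unit, and is related to the operations `N` on `B` by
`N(x₁, …, x_n) = (x₁ ⋯ x_{n-1}) ⋆ x_n - x₁ · ((x₂ ⋯ x_{n-1}) ⋆ x_n)`, where `β : B → A` is
suppressed from the notation.  If `star` is the difference of two compatible products `∘` and
`·`, these are the operations of a compatible associative algebra. -/
structure IsStar (β : B →ₗ[K] A) (N : List B → B) (star : A →ₗ[K] A →ₗ[K] A) : Prop where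
  mixed : IsMixed (LinearMap.mul K A) star
  one_left : ∀ x, star 1 x = 0
  one_right : ∀ x, star x 1 = 0
  op : ∀ a l c, β (N (a :: l ++ [c])) =
    star (listProd β (a :: l)) (β c) - β a * star (listProd β l) (β c)

/-- `∑ f(p) · q` over all `l = p ++ q` with `p` nonempty. -/
def sumMul (β : B →ₗ[K] A) (f : List B → A) (l : List B) : A :=
  ∑ k ∈ Finset.range l.length, f (l.take (k + 1)) * listProd β (l.drop (k + 1))

variable {β : B →ₗ[K] A}

lemma listProd_snoc (l : List B) (e : B) : listProd β (l ++ [e]) = listProd β l * β e := by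
  simp [listProd]

@[simp] lemma sumMul_nil (f : List B → A) : sumMul β f [] = 0 := rfl

lemma sumMul_snoc (f : List B → A) (l : List B) (e : B) :
    sumMul β f (l ++ [e]) = sumMul β f l * β e + f (l ++ [e]) := by
  rw [sumMul, sumMul, List.length_append, List.length_singleton, Finset.sum_range_succ,
    Finset.sum_mul]
  congr 1
  · refine Finset.sum_congr rfl fun k hk => ?_
    have hk : k + 1 ≤ l.length := Finset.mem_range.1 hk
    rw [List.take_append_of_le_length hk, List.drop_append_of_le_length hk, listProd_snoc,
      mul_assoc]
  · simp [List.take_of_length_le, listProd]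

lemma sumMul_sub (f g : List B → A) (l : List B) :
    sumMul β (fun p => f p - g p) l = sumMul β f l - sumMul β g l := by
  simp [sumMul, sub_mul]

lemma sumL_sumMul (N : List B → B) (f : List B → List B → A) (x : List B) (c : B) (z : List B) :
    sumL N (fun m => sumMul β (f m) z) x c
      = sumMul β (fun p => sumL N (fun m => f m p) x c) z := by
  simp only [sumL, sumMul, Finset.sum_mul]
  exact Finset.sum_comm

lemma sumR_sumMul (N : List B → B) (f : List B → A) (c : B) (z : List B) :
    sumR N (sumMul β f) c z = sumMul β (fun p => sumR N f c p) z := by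
  induction z using List.reverseRecOn with
  | nil => rfl
  | append_singleton z e ih =>
    have h : sumR N (fun m => sumMul β f (m ++ [e])) c z
        = sumR N (sumMul β f) c z * β e + sumR N (fun m => f (m ++ [e])) c z := by
      simp only [sumMul_snoc, sumR, Finset.sum_add_distrib, Finset.sum_mul]
    have h' (b : B) : sumMul β f [b] = f [b] := by simp [sumMul, listProd]
    rw [sumR_snoc, sumMul_snoc, sumR_snoc, ← ih, h, h', add_assoc]

variable {N : List B → B} {star : A →ₗ[K] A →ₗ[K] A}

namespace IsStar

variable (h : IsStar β N star)
include h

/-- The part of `(x₁ ⋯ x_k) ⋆ (z₁ ⋯ z_m)` in which an operation involves all of the left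
factor. -/
lemma star_sub (a : B) (l z : List B) :
    star (listProd β (a :: l)) (listProd β z) - β a * star (listProd β l) (listProd β z)
      = sumMul β (fun p => β (N (a :: l ++ p))) z := by
  induction z using List.reverseRecOn with
  | nil => simp [listProd, h.one_right]
  | append_singleton z e ih =>
    have h1 := h.mixed (listProd β (a :: l)) (listProd β z) (β e)
    have h2 := h.mixed (listProd β l) (listProd β z) (β e)
    have h3 := h.op a (l ++ z) e
    simp only [LinearMap.mul_apply'] at h1 h2
    rw [sumMul_snoc, ← ih, listProd_snoc, eq_sub_of_add_eq' h1.symm, eq_sub_of_add_eq' h2.symm,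
      ← List.append_assoc, List.cons_append, h3]
    simp only [listProd, List.map_cons, List.map_append, List.prod_cons, List.prod_append]
    noncomm_ring

lemma star_left (l : List B) (c : B) :
    star (listProd β l) (β c) = sumL N (listProd β) l c := by
  induction l with
  | nil => simp [listProd, h.one_left]
  | cons a l ih =>
    rw [sumL_cons, eq_add_of_sub_eq (h.op a l c).symm, ih]
    simp [listProd, sumL, Finset.mul_sum]

lemma star_right (c : B) (z : List B) :
    star (β c) (listProd β z) = sumR N (listProd β) c z := by
  have := h.star_sub c [] z
  simp only [listProd, List.map_cons, List.map_nil, List.prod_cons, List.prod_nil, mul_one,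
    h.one_left, mul_zero, sub_zero] at this
  rw [listProd, this]
  simp [sumMul, sumR, listProd]

/-- The failure of the associator of `star` to commute with the left multiplication by a
generator is given by the relations of an `𝒩`-algebra. -/
lemma associator (a : B) (l : List B) (c : B) (z : List B) :
    (star (star (listProd β (a :: l)) (β c)) (listProd β z)
        - star (listProd β (a :: l)) (star (β c) (listProd β z)))
      - β a * (star (star (listProd β l) (β c)) (listProd β z)
        - star (listProd β l) (star (β c) (listProd β z)))
      = sumMul β (fun p => β (sumL N (fun m => N (m ++ p)) (a :: l) c
          - sumR N (fun m => N (a :: l ++ m)) c p)) z := by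
  have h1 : star (star (listProd β (a :: l)) (β c)) (listProd β z)
      - β a * star (star (listProd β l) (β c)) (listProd β z)
      = sumMul β (fun p => β (sumL N (fun m => N (m ++ p)) (a :: l) c)) z := by
    have e1 : star (β (N (a :: l ++ [c]))) (listProd β z)
        = sumMul β (fun p => β (N ([N (a :: l ++ [c])] ++ p))) z := by
      simpa [listProd, h.one_left] using h.star_sub (N (a :: l ++ [c])) [] z
    have e2 : star (β a * sumL N (listProd β) l c) (listProd β z)
        - β a * star (sumL N (listProd β) l c) (listProd β z)
        = sumL N (fun m => sumMul β (fun p => β (N (a :: m ++ p))) z) l c := by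
      simp only [sumL, map_sum, LinearMap.sum_apply, Finset.mul_sum, ← Finset.sum_sub_distrib,
        ← h.star_sub, listProd, List.map_cons, List.prod_cons]
    have e3 (p : List B) : β (sumL N (fun m => N (m ++ p)) (a :: l) c)
        = sumL N (fun m => β (N (m ++ p))) (a :: l) c := by
      simp only [sumL, map_sum]
    rw [eq_add_of_sub_eq (h.op a l c).symm, h.star_left l c, map_add, LinearMap.add_apply,
      add_sub_assoc, e1, e2]
    simp only [e3]
    rw [← sumL_sumMul N (fun m p => β (N (m ++ p))), sumL_cons]
  have h2 : star (listProd β (a :: l)) (star (β c) (listProd β z))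
      - β a * star (listProd β l) (star (β c) (listProd β z))
      = sumMul β (fun p => β (sumR N (fun m => N (a :: l ++ m)) c p)) z := by
    have e3 (p : List B) : β (sumR N (fun m => N (a :: l ++ m)) c p)
        = sumR N (fun m => β (N (a :: l ++ m))) c p := by
      simp only [sumR, map_sum]
    simp only [e3]
    rw [← sumR_sumMul N (fun p => β (N (a :: l ++ p)))]
    simp only [h.star_right, sumR, map_sum, Finset.mul_sum, ← Finset.sum_sub_distrib,
      ← h.star_sub]
  simp only [map_sub]
  rw [sumMul_sub, ← h1, ← h2]
  noncomm_ring

/-- The relations of an `𝒩`-algebra make `star` associative, as far as the middle factor is a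
generator. -/
lemma assoc_of_middleRel (hN : MiddleRel N) (x : List B) (c : B) (z : List B) :
    star (star (listProd β x) (β c)) (listProd β z)
      = star (listProd β x) (star (β c) (listProd β z)) := by
  induction x with
  | nil => simp [listProd, h.one_left]
  | cons a l ih =>
    have := h.associator a l c z
    rw [ih, sub_self, mul_zero, sub_zero, sumMul, Finset.sum_eq_zero, sub_eq_zero] at this
    · exact this
    · intro k hk
      have hk := Finset.mem_range.1 hk
      rw [hN (a :: l) c (z.take (k + 1)) (by simp) (by rw [← List.length_pos_iff]; simp; omega),
        sub_self, map_zero, zero_mul]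

/-- The operations obtained from an associative `star` satisfy the relations of an
`𝒩`-algebra. -/
lemma middleRel_of_assoc (hβ : Function.Injective β) (hs : IsAssoc star) : MiddleRel N := by
  intro x c z hx hz
  obtain ⟨a, l, rfl⟩ := List.exists_cons_of_ne_nil hx
  obtain ⟨z, e, rfl⟩ := List.eq_nil_or_concat' z |>.resolve_left hz
  have h0 (z : List B) := h.associator a l c z
  simp only [hs _ _ _, sub_self, mul_zero] at h0
  have := sumMul_snoc (β := β) (fun p => β (sumL N (fun m => N (m ++ p)) (a :: l) c
          - sumR N (fun m => N (a :: l ++ m)) c p)) z e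
  -- both sums vanish, so that the summand for the whole of `z ++ [e]` does
  rw [← h0, ← h0, zero_mul, zero_add] at this
  exact sub_eq_zero.1 (hβ (this.symm.trans (map_zero β).symm))

/-- The operations obtained from `star` are multilinear. -/
lemma multilinear (hβ : Function.Injective β) (l r : List B) (hlr : 1 ≤ l.length + r.length) :
    IsLinearMap K (fun x => N (l ++ x :: r)) := by
  suffices ∃ f : B →ₗ[K] A, ∀ x, β (N (l ++ x :: r)) = f x by
    obtain ⟨f, hf⟩ := this
    exact ⟨fun x y => hβ (by simp only [map_add, hf]), fun k x => hβ (by simp only [map_smul, hf])⟩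
  rcases r.eq_nil_or_concat' with rfl | ⟨r, e, rfl⟩
  · obtain ⟨a, l, rfl⟩ := List.exists_cons_of_ne_nil (l := l) (by rintro rfl; simp at hlr)
    exact ⟨star (listProd β (a :: l)) ∘ₗ β
      - LinearMap.mulLeft K (β a) ∘ₗ star (listProd β l) ∘ₗ β, fun x => h.op a l x⟩
  · rcases l with _ | ⟨a, l⟩
    · exact ⟨star.flip (β e) ∘ₗ LinearMap.mulRight K (listProd β r) ∘ₗ β
        - LinearMap.mulRight K (star (listProd β r) (β e)) ∘ₗ β, fun x => by
          simpa [listProd] using h.op x r e⟩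
    · let g : B →ₗ[K] A := LinearMap.mulLeft K (listProd β l) ∘ₗ
        LinearMap.mulRight K (listProd β r) ∘ₗ β
      exact ⟨star.flip (β e) ∘ₗ LinearMap.mulLeft K (β a) ∘ₗ g
        - LinearMap.mulLeft K (β a) ∘ₗ star.flip (β e) ∘ₗ g, fun x => by
          simpa [listProd, g] using h.op a (l ++ x :: r) e⟩

lemma isNAlgebra (hβ : Function.Injective β) (hs : IsAssoc star) : IsNAlgebra K N :=
  isNAlgebra_iff.2 ⟨h.multilinear hβ, h.middleRel_of_assoc hβ hs⟩

end IsStar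

end Associator

/-! ### The operations of a compatible associative algebra -/

section Operations

variable {K : Type*} [Field K] {A : Type*} [AddCommGroup A] [Module K A]
  {d c : A →ₗ[K] A →ₗ[K] A}

lemma nOp_snoc (d c : A →ₗ[K] A →ₗ[K] A) (a : A) (l : List A) (z : A) :
    nOp d c (a :: l ++ [z]) = prodCirc d c (a :: l) z - d a (prodCirc d c l z) := by
  cases l with
  | nil => rfl
  | cons b l =>
    have h1 : (b :: (l ++ [z])).dropLast = b :: l := by
      rw [← List.cons_append, List.dropLast_concat]
    have h2 : (b :: (l ++ [z])).getLast (List.cons_ne_nil _ _) = z := by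
      simp
    simp only [List.cons_append, nOp, h1, h2]

/-- In a compatible associative algebra the operations `nOp` satisfy the relations of an
`𝒩`-algebra; the same holds on every subspace `j : W → A` which is closed under them. The
calculation takes place in the algebra with a unit adjoined, the difference of `∘` and `·` being
extended so that it vanishes on the unit. -/
lemma isNAlgebra_of_nOp (h : IsCompatible d c) {W : Type*} [AddCommGroup W] [Module K W]
    (j : W →ₗ[K] A) (hj : Function.Injective j) {N : List W → W}
    (hN : ∀ l, 2 ≤ l.length → j (N l) = nOp d c (l.map j)) : IsNAlgebra K N := by
  let _ : NonUnitalRing A :=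
    { (inferInstance : AddCommGroup A) with
      mul := fun x y => d x y
      left_distrib := fun x y z => map_add (d x) y z
      right_distrib := fun x y z => LinearMap.map_add₂ d x y z
      zero_mul := fun x => LinearMap.map_zero₂ d x
      mul_zero := fun x => map_zero (d x)
      mul_assoc := h.assoc_dot }
  have hmul (x y : A) : x * y = d x y := rfl
  have : IsScalarTower K A A := ⟨fun k x y => LinearMap.map_smul₂ d k x y⟩
  have : SMulCommClass K A A := ⟨fun k x y => ((d x).map_smul k y).symm⟩
  obtain ⟨-, hs, hm⟩ := isCompatible_iff.1 h.sub
  let star : Unitization K A →ₗ[K] Unitization K A →ₗ[K] Unitization K A :=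
    ((c - d).compr₂ (Unitization.inrHom K K A)).compl₁₂
      (Unitization.sndHom K K A) (Unitization.sndHom K K A)
  have hstar (x y : Unitization K A) : star x y = Unitization.inr ((c - d) x.snd y.snd) := rfl
  have hstar' (x y : A) : star (x : Unitization K A) (y : Unitization K A)
    = Unitization.inr ((c - d) x y) := rfl
  let β : W →ₗ[K] Unitization K A := Unitization.inrHom K K A ∘ₗ j
  have hβ (w : W) : β w = Unitization.inr (j w) := rfl
  have hprod (a : W) (l : List W) :
      listProd β (a :: l) = Unitization.inr (dotProd d (j a) (l.map j)) := by
    induction l generalizing a with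
    | nil => simp [listProd, dotProd, hβ]
    | cons b l ih =>
      have : listProd β (a :: b :: l) = β a * listProd β (b :: l) := rfl
      rw [this, ih, hβ, ← Unitization.inr_mul]
      rfl
  have hst : IsStar β N star :=
    { mixed := fun x y z => by
        have h1 := hm x.snd y.snd z.snd
        simp only [LinearMap.mul_apply', hstar]
        ext
        · simp [-LinearMap.sub_apply]
        · simp only [Unitization.snd_mul, Unitization.snd_add, Unitization.snd_inr,
            Unitization.fst_inr, map_add, map_smul, LinearMap.add_apply, LinearMap.smul_apply,
            zero_smul, zero_add, add_zero, hmul] at h1 ⊢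
          linear_combination (norm := abel) h1
      one_left := fun x => by simp [hstar]
      one_right := fun x => by simp [hstar]
      op := fun a l e => by
        rw [hβ, hN _ (by simp), List.map_append, List.map_cons, List.map_singleton, nOp_snoc]
        cases l with
        | nil => simp [listProd, hβ, hstar, prodCirc, dotProd]
        | cons b l =>
          rw [hprod, hprod, hβ, hstar', hβ, hstar', ← Unitization.inr_mul, ← Unitization.inr_sub,
            hmul]
          congr 1
          simp only [List.map_cons, prodCirc, dotProd, LinearMap.sub_apply, map_sub,
            h.assoc_dot _ _ _]
          abel }
  refine hst.isNAlgebra (Unitization.inr_injective.comp hj) fun x y z => ?_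
  simp only [hstar, Unitization.snd_inr, hs _ _ _]

/-- `N_n(x₁, …, x_n)` is primitive as soon as `x₁` and `x_n` are. -/
lemma nOp_primitive {Δ : A →ₗ[K] A ⊗[K] A} (hd : IsInfinitesimal d Δ) (hc : IsInfinitesimal c Δ)
    {a z : A} (ha : Δ a = 0) (hz : Δ z = 0) (l : List A) : Δ (nOp d c (a :: l ++ [z])) = 0 := by
  rw [nOp_snoc]
  cases l with
  | nil => simp [prodCirc, dotProd, hd a z, hc a z, ha, hz]
  | cons b l =>
    simp only [prodCirc, dotProd, hd a _, hc _ z, ha, hz, lTensor_rTensor, map_sub, map_add,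
      map_zero, LinearMap.rTensor_tmul, LinearMap.lTensor_tmul, LinearMap.flip_apply]
    abel

/-- The operations `N_n` on the primitive elements; the value on lists of length `< 2` is `0`, as
for `nOp`. -/
def primOp {Δ : A →ₗ[K] A ⊗[K] A} (hd : IsInfinitesimal d Δ) (hc : IsInfinitesimal c Δ)
    (l : List (primitives Δ)) : primitives Δ :=
  ⟨nOp d c (l.map Subtype.val), by
    change Δ _ = 0
    by_cases hl : 2 ≤ l.length
    · obtain ⟨a, m, z, rfl⟩ := exists_eq_cons_snoc hl
      simpa using nOp_primitive hd hc a.2 z.2 (m.map Subtype.val)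
    · match l, hl with
      | [], _ => simp [nOp]
      | [a], _ => simp [nOp]
      | a :: b :: m, hl => simp at hl⟩

end Operations

/-! ### Linear maps on the tensor algebra -/

section TensorLift

variable {K : Type*} [Field K] {B : Type*} [AddCommGroup B] [Module K B] {M : Type*}
  [AddCommGroup M] [Module K M]

/-- A function on lists is multilinear if its restriction to the lists of every given length
is. -/
def IsListMultilinear (K : Type*) [Field K] {B : Type*} [AddCommGroup B] [Module K B] {M : Type*}
    [AddCommGroup M] [Module K M] (φ : List B → M) : Prop :=
  ∀ l r : List B, IsLinearMap K (fun x => φ (l ++ x :: r))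

/-- The product in the tensor algebra of the members of a list. -/
abbrev word (K : Type*) [Field K] {B : Type*} [AddCommGroup B] [Module K B] (l : List B) :
    TensorAlgebra K B :=
  listProd (TensorAlgebra.ι K) l

lemma word_cons (a : B) (l : List B) : word K (a :: l) = TensorAlgebra.ι K a * word K l := rfl

@[simp] lemma word_nil : word K ([] : List B) = 1 := rfl

lemma word_multilinear : IsListMultilinear K (word K : List B → TensorAlgebra K B) := fun l r =>
  ⟨fun x y => by simp [word, listProd, mul_add, add_mul], fun k x => by simp [word, listProd]⟩

lemma basis_tensorAlgebra_apply {Y : Type*} (b : Module.Basis Y K B) (w : FreeMonoid Y) :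
    b.tensorAlgebra w = word K (w.toList.map b) := by
  have h : FreeAlgebra.basisFreeMonoid K Y w
      = FreeAlgebra.equivMonoidAlgebraFreeMonoid.symm (MonoidAlgebra.single w 1) := by
    simp [FreeAlgebra.basisFreeMonoid]
  rw [Module.Basis.tensorAlgebra, Module.Basis.map_apply, h]
  simp [FreeAlgebra.equivMonoidAlgebraFreeMonoid, word, listProd, FreeMonoid.lift_apply,
    map_list_prod, Function.comp_def]

lemma IsListMultilinear.ext {φ ψ : List B → M} (hφ : IsListMultilinear K φ)
    (hψ : IsListMultilinear K ψ) {Y : Type*} (b : Module.Basis Y K B)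
    (h : ∀ l : List Y, φ (l.map b) = ψ (l.map b)) (l : List B) : φ l = ψ l := by
  suffices ∀ (r : List B) (l : List Y), φ (l.map b ++ r) = ψ (l.map b ++ r) from this l []
  intro r
  induction r with
  | nil => simpa using h
  | cons x r ih =>
    intro l
    have : (hφ (l.map b) r).mk' = (hψ (l.map b) r).mk' := b.ext fun y => by
      simpa using ih (l ++ [y])
    exact LinearMap.congr_fun this x

/-- The linear map on the tensor algebra whose value on a product of elements of `B` is given by
the multilinear function `φ` on lists. It is defined on the words in a basis. -/
def tensorLift (φ : List B → M) : TensorAlgebra K B →ₗ[K] M :=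
  (Module.Basis.ofVectorSpace K B).tensorAlgebra.constr K
    fun w => φ (w.toList.map (Module.Basis.ofVectorSpace K B))

lemma tensorLift_word {φ : List B → M} (hφ : IsListMultilinear K φ) (l : List B) :
    tensorLift φ (word K l) = φ l := by
  refine IsListMultilinear.ext (K := K) (φ := fun l => tensorLift φ (word K l)) (fun l r => ?_) hφ
    (Module.Basis.ofVectorSpace K B) (fun l => ?_) l
  · have h := word_multilinear (K := K) l r
    exact ⟨fun x y => by simp only [h.map_add, map_add],
      fun k x => by simp only [h.map_smul, map_smul]⟩
  · have := basis_tensorAlgebra_apply (Module.Basis.ofVectorSpace K B) (FreeMonoid.ofList l)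
    rw [FreeMonoid.toList_ofList] at this
    rw [← this, tensorLift, Module.Basis.constr_basis, FreeMonoid.toList_ofList]

lemma mem_of_word_mem (S : Submodule K (TensorAlgebra K B)) (h : ∀ l, word K l ∈ S)
    (x : TensorAlgebra K B) : x ∈ S := by
  let b := (Module.Basis.ofVectorSpace K B).tensorAlgebra
  have : ⊤ ≤ S := by
    rw [← b.span_eq, Submodule.span_le]
    rintro _ ⟨w, rfl⟩
    exact basis_tensorAlgebra_apply (Module.Basis.ofVectorSpace K B) w ▸ h _
  exact this trivial

lemma tensor_ext {f g : TensorAlgebra K B →ₗ[K] M} (h : ∀ l, f (word K l) = g (word K l)) :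
    f = g :=
  LinearMap.ext fun x => mem_of_word_mem (LinearMap.eqLocus f g) h x

end TensorLift

/-! ### The enveloping algebra of an `𝒩`-algebra -/

section Enveloping

open TensorAlgebra

variable {K : Type*} [Field K] {B : Type*} [AddCommGroup B] [Module K B] {N : List B → B}

/-- The linear map `c ↦ N(a, l₁, …, l_k, c)`. -/
def opLast (hN : IsNAlgebra K N) (a : B) (l : List B) : B →ₗ[K] B :=
  (hN.multilinear (a :: l) [] (by simp)).mk'

lemma opLast_apply (hN : IsNAlgebra K N) (a : B) (l : List B) (c : B) :
    opLast hN a l c = N (a :: l ++ [c]) := rfl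

/-- `(l₁ ⋯ l_k) ⋆ c` for `c ∈ B`, that is, the sum of the `u · N(v, c)` over all `l = u ++ v` with
`v` nonempty. -/
def starLetter (hN : IsNAlgebra K N) : List B → B →ₗ[K] TensorAlgebra K B
  | [] => 0
  | a :: l => ι K ∘ₗ opLast hN a l + LinearMap.mulLeft K (ι K a) ∘ₗ starLetter hN l

lemma starLetter_multilinear (hN : IsNAlgebra K N) :
    IsListMultilinear K (starLetter hN) := by
  have hop (l : List B) (r : List B) (c : B) := hN.multilinear l (r ++ [c]) (by simp; omega)
  intro l r
  induction l with
  | nil =>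
    have h := hop [] r
    simp only [List.nil_append] at h
    refine ⟨fun x y => LinearMap.ext fun c => ?_, fun k x => LinearMap.ext fun c => ?_⟩
    · simp only [List.nil_append, starLetter, LinearMap.add_apply, LinearMap.comp_apply,
        LinearMap.mulLeft_apply, opLast_apply, List.cons_append, (h c).map_add, map_add, add_mul]
      abel
    · simp only [List.nil_append, starLetter, LinearMap.add_apply, LinearMap.comp_apply,
        LinearMap.mulLeft_apply, opLast_apply, List.cons_append, (h c).map_smul, map_smul,
        smul_mul_assoc, smul_add, LinearMap.smul_apply]
  | cons a l ih =>
    have h := hop (a :: l) r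
    simp only [List.cons_append] at h
    refine ⟨fun x y => LinearMap.ext fun c => ?_, fun k x => LinearMap.ext fun c => ?_⟩
    · simp only [List.cons_append, starLetter, LinearMap.add_apply, LinearMap.comp_apply,
        LinearMap.mulLeft_apply, opLast_apply, List.append_assoc, (h c).map_add, map_add,
        ih.map_add]
      abel
    · simp only [List.cons_append, starLetter, LinearMap.add_apply, LinearMap.comp_apply,
        LinearMap.mulLeft_apply, opLast_apply, List.append_assoc, (h c).map_smul, map_smul,
        ih.map_smul, smul_add, LinearMap.smul_apply]

/-- The map `x ↦ x ⋆ (l₁ ⋯ l_k)`, by recursion on `l` along the compatibility condition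
`x ⋆ (c · z) = (x · c) ⋆ z + (x ⋆ c) · z - x · (c ⋆ z)`. -/
def starWord (hN : IsNAlgebra K N) : List B → TensorAlgebra K B →ₗ[K] TensorAlgebra K B
  | [] => 0
  | c :: z => starWord hN z ∘ₗ LinearMap.mulRight K (ι K c)
      + LinearMap.mulRight K (word K z) ∘ₗ (tensorLift (starLetter hN)).flip c
      - LinearMap.mulRight K (starWord hN z (ι K c))

lemma starWord_cons (hN : IsNAlgebra K N) (c : B) (z : List B) (x : TensorAlgebra K B) :
    starWord hN (c :: z) x = starWord hN z (x * ι K c)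
      + tensorLift (starLetter hN) x c * word K z - x * starWord hN z (ι K c) := rfl

lemma starWord_multilinear (hN : IsNAlgebra K N) : IsListMultilinear K (starWord hN) := by
  intro l r
  induction l with
  | nil =>
    refine ⟨fun x y => LinearMap.ext fun c => ?_, fun k x => LinearMap.ext fun c => ?_⟩
    · simp only [List.nil_append, starWord_cons, LinearMap.add_apply, map_add, mul_add, add_mul]
      abel
    · simp only [List.nil_append, starWord_cons, map_smul, mul_smul_comm, smul_mul_assoc,
        smul_add, smul_sub, LinearMap.smul_apply]
  | cons a l ih =>
    have h := word_multilinear (K := K) l r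
    refine ⟨fun x y => LinearMap.ext fun c => ?_, fun k x => LinearMap.ext fun c => ?_⟩
    · simp only [List.cons_append, starWord_cons, LinearMap.add_apply, ih.map_add, h.map_add,
        mul_add]
      abel
    · simp only [List.cons_append, starWord_cons, ih.map_smul, h.map_smul, mul_smul_comm,
        smul_add, smul_sub, LinearMap.smul_apply]

/-- The product `⋆`, the difference of `∘` and `·`, on the enveloping algebra. -/
def envStar (hN : IsNAlgebra K N) :
    TensorAlgebra K B →ₗ[K] TensorAlgebra K B →ₗ[K] TensorAlgebra K B :=
  (tensorLift (starWord hN)).flip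

lemma envStar_word (hN : IsNAlgebra K N) (x : TensorAlgebra K B) (z : List B) :
    envStar hN x (word K z) = starWord hN z x := by
  rw [envStar, LinearMap.flip_apply, tensorLift_word (starWord_multilinear hN)]

lemma word_singleton (c : B) : word K [c] = ι K c := by simp [word, listProd]

lemma envStar_one_right (hN : IsNAlgebra K N) (x : TensorAlgebra K B) : envStar hN x 1 = 0 :=
  envStar_word hN x []

lemma envStar_letter (hN : IsNAlgebra K N) (x : TensorAlgebra K B) (c : B) :
    envStar hN x (ι K c) = tensorLift (starLetter hN) x c := by
  rw [← word_singleton, envStar_word, starWord_cons]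
  simp [starWord]

lemma envStar_word_letter_cons (hN : IsNAlgebra K N) (a : B) (l : List B) (c : B) :
    envStar hN (word K (a :: l)) (ι K c)
      = ι K (N (a :: l ++ [c])) + ι K a * envStar hN (word K l) (ι K c) := by
  rw [envStar_letter, envStar_letter, tensorLift_word (starLetter_multilinear hN),
    tensorLift_word (starLetter_multilinear hN)]
  rfl

lemma envStar_one_left (hN : IsNAlgebra K N) (x : TensorAlgebra K B) : envStar hN 1 x = 0 := by
  refine mem_of_word_mem (LinearMap.ker (envStar hN 1)) (fun l => ?_) x
  rw [LinearMap.mem_ker, envStar_word]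
  have h1 (c : B) : tensorLift (starLetter hN) (1 : TensorAlgebra K B) c = 0 := by
    rw [← word_nil, tensorLift_word (starLetter_multilinear hN)]
    rfl
  induction l with
  | nil => rfl
  | cons c z ih => simp [starWord_cons, h1]

lemma envStar_mixed (hN : IsNAlgebra K N) :
    IsMixed (LinearMap.mul K (TensorAlgebra K B)) (envStar hN) := by
  have hassoc : IsAssoc (LinearMap.mul K (TensorAlgebra K B)) := fun x y z => mul_assoc x y z
  have letter (c : B) (x z : TensorAlgebra K B) : envStar hN (x * ι K c) z
      + envStar hN x (ι K c) * z = x * envStar hN (ι K c) z + envStar hN x (ι K c * z) := by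
    let S : Submodule K (TensorAlgebra K B) := LinearMap.eqLocus
      (envStar hN (x * ι K c) + LinearMap.mulLeft K (envStar hN x (ι K c)))
      (LinearMap.mulLeft K x ∘ₗ envStar hN (ι K c) +
        envStar hN x ∘ₗ LinearMap.mulLeft K (ι K c))
    refine mem_of_word_mem S (fun l => ?_) z
    simp only [S, LinearMap.mem_eqLocus, LinearMap.add_apply, LinearMap.comp_apply,
      LinearMap.mulLeft_apply]
    rw [← word_cons, envStar_word, envStar_word, envStar_word, starWord_cons, envStar_letter]
    abel
  intro x y z
  let S : Submodule K (TensorAlgebra K B) :=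
    { carrier := {y | ∀ x z, envStar hN (x * y) z + envStar hN x y * z
        = x * envStar hN y z + envStar hN x (y * z)}
      zero_mem' := by simp
      add_mem' := fun h h' x z => by
        simp only [mul_add, add_mul, map_add, LinearMap.add_apply]
        linear_combination (norm := abel) h x z + h' x z
      smul_mem' := fun k y h x z => by
        simp only [mul_smul_comm, smul_mul_assoc, map_smul, LinearMap.smul_apply, ← smul_add,
          h x z] }
  refine mem_of_word_mem S (fun l => ?_) y x z
  induction l with
  | nil =>
    intro x z
    simp [envStar_one_left, envStar_one_right]
  | cons a l ih => exact mixed_mul_middle hassoc (letter a) ih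

lemma envStar_isStar (hN : IsNAlgebra K N) : IsStar (ι K) N (envStar hN) where
  mixed := envStar_mixed hN
  one_left := envStar_one_left hN
  one_right := envStar_one_right hN
  op a l c := eq_sub_of_add_eq (envStar_word_letter_cons hN a l c).symm

lemma envStar_assoc (hN : IsNAlgebra K N) : IsAssoc (envStar hN) := by
  have letter (c : B) (x z : TensorAlgebra K B) :
      envStar hN (envStar hN x (ι K c)) z = envStar hN x (envStar hN (ι K c) z) := by
    have h1 (l : List B) : envStar hN (envStar hN (word K l) (ι K c))
        = envStar hN (word K l) ∘ₗ envStar hN (ι K c) :=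
      tensor_ext fun m => (envStar_isStar hN).assoc_of_middleRel (isNAlgebra_iff.1 hN).2 l c m
    have h2 : envStar hN ∘ₗ (envStar hN).flip (ι K c)
        = LinearMap.lcomp K _ (envStar hN (ι K c)) ∘ₗ envStar hN := tensor_ext h1
    exact LinearMap.congr_fun₂ h2 x z
  intro x y z
  let S : Submodule K (TensorAlgebra K B) :=
    { carrier := {y | ∀ x z, envStar hN (envStar hN x y) z = envStar hN x (envStar hN y z)}
      zero_mem' := by simp
      add_mem' := fun h h' x z => by simp [h x z, h' x z]
      smul_mem' := fun k y h x z => by simp [h x z] }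
  refine mem_of_word_mem S (fun l => ?_) y x z
  induction l with
  | nil =>
    intro x z
    simp [envStar_one_left, envStar_one_right]
  | cons a l ih => exact assoc_mul_middle (envStar_mixed hN) (letter a) ih

/-- The product `∘` on the enveloping algebra; as `⋆` vanishes on the unit of the tensor algebra,
this is also the unit of `∘`. -/
def envCirc (hN : IsNAlgebra K N) :
    TensorAlgebra K B →ₗ[K] TensorAlgebra K B →ₗ[K] TensorAlgebra K B :=
  LinearMap.mul K _ + envStar hN

lemma envCirc_apply (hN : IsNAlgebra K N) (x y : TensorAlgebra K B) :
    envCirc hN x y = x * y + envStar hN x y := rfl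

theorem env_isCompatible (hN : IsNAlgebra K N) :
    IsCompatible (LinearMap.mul K (TensorAlgebra K B)) (envCirc hN) :=
  (isCompatible_iff.2 ⟨fun x y z => mul_assoc x y z, envStar_assoc hN, envStar_mixed hN⟩).add

lemma envCirc_one_left (hN : IsNAlgebra K N) (x : TensorAlgebra K B) : envCirc hN 1 x = x := by
  rw [envCirc_apply, envStar_one_left, one_mul, add_zero]

lemma envCirc_one_right (hN : IsNAlgebra K N) (x : TensorAlgebra K B) : envCirc hN x 1 = x := by
  rw [envCirc_apply, envStar_one_right, mul_one, add_zero]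

lemma envCirc_word_letter_cons (hN : IsNAlgebra K N) (a : B) (l : List B) (c : B) :
    envCirc hN (word K (a :: l)) (ι K c)
      = ι K (N (a :: l ++ [c])) + ι K a * envCirc hN (word K l) (ι K c) := by
  rw [envCirc_apply, envStar_word_letter_cons, envCirc_apply, word_cons]
  noncomm_ring

lemma dotProd_env (a : B) (l : List B) :
    dotProd (LinearMap.mul K (TensorAlgebra K B)) (ι K a) (l.map (ι K)) = word K (a :: l) := by
  induction l generalizing a with
  | nil => simp [dotProd, word_singleton]
  | cons b l ih =>
    rw [List.map_cons, dotProd, ih]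
    rfl

lemma prodCirc_env (hN : IsNAlgebra K N) (l : List B) (c : B) :
    prodCirc (LinearMap.mul K _) (envCirc hN) (l.map (ι K)) (ι K c)
      = envCirc hN (word K l) (ι K c) := by
  cases l with
  | nil => simp [prodCirc, envCirc_one_left]
  | cons a l => rw [List.map_cons, prodCirc, dotProd_env]

/-- The operations of the enveloping algebra extend those of the `𝒩`-algebra. -/
lemma nOp_env (hN : IsNAlgebra K N) {l : List B} (hl : 2 ≤ l.length) :
    nOp (LinearMap.mul K _) (envCirc hN) (l.map (ι K)) = ι K (N l) := by
  obtain ⟨a, m, e, rfl⟩ := exists_eq_cons_snoc hl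
  rw [List.map_append, List.map_cons, List.map_singleton, nOp_snoc, ← List.map_cons,
    prodCirc_env, prodCirc_env, envCirc_word_letter_cons]
  exact add_sub_cancel_right _ _

/-! ### The coproduct of the enveloping algebra -/

variable (K) in
/-- The deconcatenation coproduct on words. The value `-1 ⊗ 1` on the empty word is the one
which is forced by the infinitesimal relation for `1 · 1`. -/
def comulWord : List B → TensorAlgebra K B ⊗[K] TensorAlgebra K B
  | [] => -(1 ⊗ₜ 1)
  | a :: l => (LinearMap.mulLeft K (ι K a)).rTensor _ (comulWord l) + ι K a ⊗ₜ word K l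

lemma comulWord_multilinear : IsListMultilinear K (comulWord K : List B → _) := by
  have hadd (u v : TensorAlgebra K B) :
      LinearMap.mulLeft K (u + v) = LinearMap.mulLeft K u + LinearMap.mulLeft K v := by
    ext1; simp [add_mul]
  have hsmul (k : K) (u : TensorAlgebra K B) :
      LinearMap.mulLeft K (k • u) = k • LinearMap.mulLeft K u := by
    ext1; simp
  intro l r
  induction l with
  | nil =>
    refine ⟨fun x y => ?_, fun k x => ?_⟩
    · simp only [List.nil_append, comulWord, hadd, LinearMap.rTensor_add, LinearMap.add_apply,
        map_add, TensorProduct.add_tmul]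
      abel
    · simp only [List.nil_append, comulWord, hsmul, LinearMap.rTensor_smul, LinearMap.smul_apply,
        map_smul, TensorProduct.smul_tmul', smul_add]
  | cons a l ih =>
    have h := word_multilinear (K := K) l r
    refine ⟨fun x y => ?_, fun k x => ?_⟩
    · simp only [List.cons_append, comulWord, ih.map_add, h.map_add, map_add,
        TensorProduct.tmul_add]
      abel
    · simp only [List.cons_append, comulWord, ih.map_smul, h.map_smul, map_smul,
        TensorProduct.tmul_smul, smul_add]

variable (K B) in
/-- The coproduct of the enveloping algebra. -/
def envComul : TensorAlgebra K B →ₗ[K] TensorAlgebra K B ⊗[K] TensorAlgebra K B :=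
  tensorLift (comulWord K)

lemma envComul_one : envComul K B 1 = -(1 ⊗ₜ 1) := tensorLift_word comulWord_multilinear []

lemma envComul_ι_mul (a : B) (x : TensorAlgebra K B) : envComul K B (ι K a * x)
    = (LinearMap.mulLeft K (ι K a)).rTensor _ (envComul K B x) + ι K a ⊗ₜ x := by
  let S : Submodule K (TensorAlgebra K B) := LinearMap.eqLocus
    (envComul K B ∘ₗ LinearMap.mulLeft K (ι K a))
    ((LinearMap.mulLeft K (ι K a)).rTensor _ ∘ₗ envComul K B + TensorProduct.mk K _ _ (ι K a))
  refine mem_of_word_mem S (fun l => ?_) x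
  simp only [S, LinearMap.mem_eqLocus, LinearMap.add_apply, LinearMap.comp_apply,
    LinearMap.mulLeft_apply, TensorProduct.mk_apply]
  simp only [← word_cons, envComul, tensorLift_word comulWord_multilinear, comulWord]

lemma envComul_ι (a : B) : envComul K B (ι K a) = 0 := by
  have := envComul_ι_mul (K := K) a 1
  simpa [envComul_one] using this

lemma envComul_infinitesimal_mul :
    IsInfinitesimal (LinearMap.mul K (TensorAlgebra K B)) (envComul K B) := by
  intro x y
  let S : Submodule K (TensorAlgebra K B) :=
    { carrier := {x | ∀ y, envComul K B (LinearMap.mul K _ x y)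
        = ((LinearMap.mul K _).flip y).lTensor _ (envComul K B x)
          + (LinearMap.mul K _ x).rTensor _ (envComul K B y) + x ⊗ₜ[K] y}
      zero_mem' := by simp
      add_mem' := fun h h' x => by
        simp only [map_add, h x, h' x, TensorProduct.add_tmul, LinearMap.rTensor_add,
          LinearMap.add_apply]
        abel
      smul_mem' := fun k z h x => by
        simp only [map_smul, h x, smul_add, TensorProduct.smul_tmul', LinearMap.rTensor_smul,
          LinearMap.smul_apply] }
  refine mem_of_word_mem S (fun l => ?_) x y
  induction l with
  | nil =>
    intro y
    have : LinearMap.mul K (TensorAlgebra K B) 1 = LinearMap.id := by ext1; simp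
    simp [word_nil, this, envComul_one]
  | cons a l ih =>
    refine infinitesimal_mul_left (fun x y z => mul_assoc x y z) (fun y => ?_) ih
    rw [LinearMap.mul_apply', envComul_ι_mul, envComul_ι, map_zero, zero_add]
    rfl

lemma envComul_infinitesimal_circ (hN : IsNAlgebra K N) :
    IsInfinitesimal (envCirc hN) (envComul K B) := by
  intro x y
  let S : Submodule K (TensorAlgebra K B) :=
    { carrier := {y | ∀ x, envComul K B (envCirc hN x y)
        = ((envCirc hN).flip y).lTensor _ (envComul K B x)
          + (envCirc hN x).rTensor _ (envComul K B y) + x ⊗ₜ[K] y}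
      zero_mem' := by simp
      add_mem' := fun h h' x => by
        simp only [map_add, h x, h' x, TensorProduct.tmul_add, LinearMap.lTensor_add,
          LinearMap.add_apply]
        abel
      smul_mem' := fun k z h x => by
        simp only [map_smul, h x, smul_add, TensorProduct.tmul_smul, LinearMap.lTensor_smul,
          LinearMap.smul_apply] }
  refine mem_of_word_mem S (fun l => ?_) y x
  induction l with
  | nil =>
    intro x
    have : (envCirc hN).flip 1 = LinearMap.id := LinearMap.ext fun z => envCirc_one_right hN z
    simp [word_nil, this, envComul_one, envCirc_one_right]
  | cons c z ih =>
    refine infinitesimal_mul_right (isCompatible_iff.1 (env_isCompatible hN)).2.2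
      envComul_infinitesimal_mul (fun x => ?_) ih
    simp only [envComul_ι, map_zero, add_zero]
    let S' : Submodule K (TensorAlgebra K B) := LinearMap.eqLocus
      (envComul K B ∘ₗ (envCirc hN).flip (ι K c))
      (((envCirc hN).flip (ι K c)).lTensor _ ∘ₗ envComul K B
        + (TensorProduct.mk K _ _).flip (ι K c))
    refine mem_of_word_mem S' (fun l => ?_) x
    simp only [S', LinearMap.mem_eqLocus, LinearMap.add_apply, LinearMap.comp_apply,
      TensorProduct.mk_apply, LinearMap.flip_apply]
    induction l with
    | nil => simp [word_nil, envCirc_one_left, envComul_ι, envComul_one]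
    | cons a l ih =>
      rw [envCirc_word_letter_cons, map_add, envComul_ι, envComul_ι_mul, ih, word_cons,
        envComul_ι_mul]
      simp only [map_add, lTensor_rTensor, LinearMap.rTensor_tmul, LinearMap.lTensor_tmul,
        LinearMap.flip_apply, LinearMap.mulLeft_apply, zero_add]
      abel

/-- The projection of the tensor algebra to its part of degree one, on words. -/
def letterWord : List B → B
  | [b] => b
  | _ => 0

lemma letterWord_multilinear : IsListMultilinear K (letterWord : List B → B) := by
  intro l r
  match l, r with
  | [], [] => exact ⟨fun _ _ => rfl, fun _ _ => rfl⟩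
  | [], a :: r => exact ⟨fun _ _ => by simp [letterWord], fun _ _ => by simp [letterWord]⟩
  | [a], r => exact ⟨fun _ _ => by simp [letterWord], fun _ _ => by simp [letterWord]⟩
  | a :: b :: l, r => exact ⟨fun _ _ => by simp [letterWord], fun _ _ => by simp [letterWord]⟩

variable (K B) in
/-- The projection of the tensor algebra to its part of degree one. -/
def letter : TensorAlgebra K B →ₗ[K] B := tensorLift letterWord

lemma letter_word (l : List B) : letter K B (word K l) = letterWord l :=
  tensorLift_word letterWord_multilinear l

lemma letter_ι (b : B) : letter K B (ι K b) = b := by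
  rw [← word_singleton, letter_word]
  rfl

lemma letter_ι_mul_ι_mul (a c : B) (x : TensorAlgebra K B) :
    letter K B (ι K a * (ι K c * x)) = 0 :=
  mem_of_word_mem (LinearMap.ker (letter K B ∘ₗ LinearMap.mulLeft K (ι K a) ∘ₗ
    LinearMap.mulLeft K (ι K c))) (fun l => letter_word (a :: c :: l)) x

/-- The primitive elements of the enveloping algebra of `B` are the elements of `B`: a word of
length at least two is recovered from its coproduct by multiplying the terms whose left factor
has degree one. -/
lemma eq_ι_of_envComul_eq_zero {x : TensorAlgebra K B} (hx : envComul K B x = 0) :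
    x = ι K (letter K B x) := by
  let ε : TensorAlgebra K B →ₐ[K] K := algebraMapInv
  have hε (b : B) : ε (ι K b) = 0 := by simp [ε, algebraMapInv]
  let E : TensorAlgebra K B ⊗[K] TensorAlgebra K B →ₗ[K] TensorAlgebra K B :=
    TensorProduct.lift (LinearMap.mul K _ ∘ₗ ι K ∘ₗ letter K B)
  have hE (p q : TensorAlgebra K B) : E (p ⊗ₜ q) = ι K (letter K B p) * q := rfl
  have hE' (a c : B) (t : TensorAlgebra K B ⊗[K] TensorAlgebra K B) :
      E ((LinearMap.mulLeft K (ι K a)).rTensor _ ((LinearMap.mulLeft K (ι K c)).rTensor _ t))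
        = 0 := by
    induction t with
    | zero => simp
    | add t t' h h' => simp only [map_add, h, h', add_zero]
    | tmul p q => simp [hE, letter_ι_mul_ι_mul]
  -- the terms are the parts of degree zero, of degree one and of degree at least two
  have h1 : LinearMap.id = Algebra.linearMap K _ ∘ₗ ε.toLinearMap + ι K ∘ₗ letter K B
      + E ∘ₗ envComul K B := by
    refine tensor_ext fun l => ?_
    simp only [LinearMap.id_apply, LinearMap.add_apply, LinearMap.comp_apply, letter_word,
      Algebra.linearMap_apply, AlgHom.toLinearMap_apply]
    have h0 : letter K B 1 = 0 := letter_word []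
    match l with
    | [] => simp [word_nil, letterWord, envComul_one, hE, h0]
    | [a] => simp [word_singleton, letterWord, hε, envComul_ι]
    | a :: c :: l =>
      have h2 : letter K B (ι K a * ι K c) = 0 := by
        simpa [word_cons, letterWord] using letter_word (K := K) [a, c]
      simp [word_cons, letterWord, hε, envComul_ι_mul, hE, hE', h2, letter_ι]
  -- the part of degree zero is also determined by the coproduct, since `1 ↦ -1 ⊗ 1`
  have h2 : ε.toLinearMap = -(TensorProduct.lift (LinearMap.mul K K) ∘ₗ
      TensorProduct.map ε.toLinearMap ε.toLinearMap ∘ₗ envComul K B) := by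
    refine tensor_ext fun l => ?_
    cases l with
    | nil => simp [word_nil, envComul_one]
    | cons a l =>
      have h3 (t : TensorAlgebra K B ⊗[K] TensorAlgebra K B) :
          TensorProduct.map ε.toLinearMap ε.toLinearMap
            ((LinearMap.mulLeft K (ι K a)).rTensor _ t) = 0 := by
        induction t with
        | zero => simp
        | add t t' h h' => simp only [map_add, h, h', add_zero]
        | tmul p q => simp [hε]
      simp [word_cons, hε, envComul_ι_mul, h3]
  have h3 : ε x = 0 := by simpa [hx] using LinearMap.congr_fun h2 x
  simpa [hx, h3] using LinearMap.congr_fun h1 x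

end Enveloping

/-! ### Freeness of the primitive elements -/

section Hom

variable {K : Type*} [Field K] {A : Type*} [AddCommGroup A] [Module K A]
  {A' : Type*} [AddCommGroup A'] [Module K A'] {d c : A →ₗ[K] A →ₗ[K] A}
  {d' c' : A' →ₗ[K] A' →ₗ[K] A'} {g : A →ₗ[K] A'}

lemma map_dotProd (hd : ∀ x y, g (d x y) = d' (g x) (g y)) (a : A) (l : List A) :
    g (dotProd d a l) = dotProd d' (g a) (l.map g) := by
  induction l generalizing a with
  | nil => rfl
  | cons b l ih => rw [dotProd, hd, ih]; rfl

lemma map_nOp (hd : ∀ x y, g (d x y) = d' (g x) (g y)) (hc : ∀ x y, g (c x y) = c' (g x) (g y))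
    {l : List A} (hl : 2 ≤ l.length) : g (nOp d c l) = nOp d' c' (l.map g) := by
  have h (l : List A) (z : A) : g (prodCirc d c l z) = prodCirc d' c' (l.map g) (g z) := by
    cases l with
    | nil => rfl
    | cons a l => rw [prodCirc, hc, map_dotProd hd]; rfl
  obtain ⟨a, m, e, rfl⟩ := exists_eq_cons_snoc hl
  rw [List.map_append, List.map_cons, List.map_singleton, nOp_snoc, nOp_snoc, map_sub, hd, h, h,
    List.map_cons]

end Hom

section DotWord

variable {K : Type*} [Field K] {A : Type*} [AddCommGroup A] [Module K A] {W : Type*}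
  [AddCommGroup W] [Module K W] (d : A →ₗ[K] A →ₗ[K] A) (j : W →ₗ[K] A)

/-- The product in `A` of the members of a list in `W`, where `A` has no unit; the value on the
empty list is `0`. -/
def dotWord : List W → A
  | [] => 0
  | a :: l => dotProd d (j a) (l.map j)

lemma dotWord_cons (a : W) {l : List W} (hl : l ≠ []) :
    dotWord d j (a :: l) = d (j a) (dotWord d j l) := by
  obtain ⟨b, l, rfl⟩ := List.exists_cons_of_ne_nil hl
  rfl

lemma dotWord_append (hd : IsAssoc d) {l m : List W} (hl : l ≠ []) (hm : m ≠ []) :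
    dotWord d j (l ++ m) = d (dotWord d j l) (dotWord d j m) := by
  induction l with
  | nil => exact absurd rfl hl
  | cons a l ih =>
    rcases eq_or_ne l [] with rfl | h
    · exact dotWord_cons d j a hm
    · rw [List.cons_append, dotWord_cons d j a (by simp [h]), ih h, dotWord_cons d j a h, hd]

lemma dotWord_multilinear : IsListMultilinear K (dotWord d j) := by
  intro l r
  induction l with
  | nil =>
    rcases eq_or_ne r [] with rfl | h
    · exact j.isLinear
    · simp only [List.nil_append, dotWord_cons d j _ h]
      exact (d.flip (dotWord d j r) ∘ₗ j).isLinear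
  | cons a l ih =>
    have h (x : W) : l ++ x :: r ≠ [] := by simp
    simp only [List.cons_append, dotWord_cons d j a (h _)]
    exact (d (j a) ∘ₗ ih.mk').isLinear

end DotWord

section Prim

variable {K : Type*} [Field K] {X : Type*}

/-- The operations `N_n` on the primitive elements of the algebra of trees. -/
abbrev treeOp : List (primitives (treeComul K X)) → primitives (treeComul K X) :=
  primOp treeComul_infinitesimal_dot treeComul_infinitesimal_circ

lemma treeOp_isNAlgebra : IsNAlgebra K (treeOp : List (primitives (treeComul K X)) → _) :=
  isNAlgebra_of_nOp treeAlg_isCompatible (Submodule.subtype _) Subtype.val_injective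
    fun _ _ => rfl

/-- The tree of degree one coloured by `a`, as a primitive element. -/
def primLeaf (K : Type*) [Field K] {X : Type*} (a : X) : primitives (treeComul K X) :=
  ⟨tr K (.leaf a), by simp [primitives, comulTree]⟩

/-- A map from `X` to an `𝒩`-algebra `B` extends to a homomorphism `F` from the trees to the
enveloping algebra of `B`. It preserves the coproduct, and so restricts to a homomorphism `g` of
`𝒩`-algebras on the primitive elements. -/
lemma exists_primHom {B : Type*} [AddCommGroup B] [Module K B] {N : List B → B}
    (hN : IsNAlgebra K N) (f : X → B) :
    ∃ (F : TreeAlg K X →ₗ[K] TensorAlgebra K B) (g : primitives (treeComul K X) →ₗ[K] B),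
      (∀ x y, F (treeDot K X x y) = F x * F y) ∧
      (∀ x : primitives (treeComul K X), F x = TensorAlgebra.ι K (g x)) ∧
      (∀ l, 2 ≤ l.length → g (treeOp l) = N (l.map g)) ∧
      ∀ a, g (primLeaf K a) = f a := by
  let b : Module.Basis X K (X →₀ K) := Finsupp.basisSingleOne
  obtain ⟨F, ⟨hdot, hcirc, hF⟩, -⟩ := (treeAlg_isFree b).2 (TensorAlgebra K B) _ _
    (env_isCompatible hN) (b.constr K fun a => TensorAlgebra.ι K (f a))
  have hleaf (a : X) : F (tr K (.leaf a)) = TensorAlgebra.ι K (f a) := by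
    simpa [treeIncl] using hF (b a)
  let S : Submodule K (TreeAlg K X) :=
    LinearMap.eqLocus (TensorProduct.map F F ∘ₗ treeComul K X) (envComul K B ∘ₗ F)
  have hSleaf (a : X) : tr K (.leaf a) ∈ S := by
    simp [S, comulTree, hleaf, envComul_ι]
  have hcomul (x : TreeAlg K X) : TensorProduct.map F F (treeComul K X x) = envComul K B (F x) :=
    treeAlg_generated S hSleaf
      (fun x hx y hy => map_comul_mul treeComul_infinitesimal_dot envComul_infinitesimal_mul hdot
        hx hy)
      (fun x hx a => map_comul_mul treeComul_infinitesimal_circ (envComul_infinitesimal_circ hN)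
        hcirc hx (hSleaf a)) x
  let g : primitives (treeComul K X) →ₗ[K] B := letter K B ∘ₗ F ∘ₗ Submodule.subtype _
  have hg (x : primitives (treeComul K X)) : F x = TensorAlgebra.ι K (g x) := by
    refine eq_ι_of_envComul_eq_zero ?_
    rw [← hcomul, show treeComul K X x = 0 from x.2, map_zero]
  refine ⟨F, g, hdot, hg, fun l hl => ?_, fun a => ?_⟩
  · refine Function.LeftInverse.injective (TensorAlgebra.ι_leftInverse (R := K) (M := B)) ?_
    rw [← hg, ← nOp_env hN (by simpa using hl)]
    change F (nOp _ _ (l.map Subtype.val)) = _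
    rw [map_nOp hdot hcirc (by simpa using hl)]
    congr 1
    simp only [List.map_map]
    exact List.map_congr_left fun x _ => hg x
  · change letter K B (F (tr K (.leaf a))) = f a
    rw [hleaf, letter_ι]

/-- The primitive elements are generated by the trees of degree one as an `𝒩`-algebra. -/
lemma prim_generated (P : Submodule K (primitives (treeComul K X)))
    (hleaf : ∀ a, primLeaf K a ∈ P)
    (hop : ∀ l : List (primitives (treeComul K X)), 2 ≤ l.length → (∀ x ∈ l, x ∈ P) →
      treeOp l ∈ P) (x : primitives (treeComul K X)) : x ∈ P := by
  obtain ⟨F, g, hdot, hg, hgop, hgleaf⟩ :=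
    exists_primHom (K := K) treeOp_isNAlgebra (primLeaf K (X := X))
  let j := (primitives (treeComul K X)).subtype
  let Q : Submodule K (primitives (treeComul K X)) := P ⊓ LinearMap.eqLocus g LinearMap.id
  have hQleaf (a : X) : primLeaf K a ∈ Q := ⟨hleaf a, hgleaf a⟩
  have hQop (l : List (primitives (treeComul K X))) (hl : 2 ≤ l.length) (h : ∀ x ∈ l, x ∈ Q) :
      treeOp l ∈ Q := by
    refine ⟨hop l hl fun x hx => (h x hx).1, ?_⟩
    change g (treeOp l) = treeOp l
    rw [hgop l hl, List.map_congr_left (g := id) fun x hx => (h x hx).2]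
    simp
  -- the span of the products of elements of `Q`, which is the whole algebra
  let S : Submodule K (TreeAlg K X) :=
    Submodule.span K {w | ∃ l, l ≠ [] ∧ (∀ x ∈ l, x ∈ Q) ∧ w = dotWord (treeDot K X) j l}
  have hword (l) (hl : l ≠ []) (h : ∀ x ∈ l, x ∈ Q) : dotWord (treeDot K X) j l ∈ S :=
    Submodule.subset_span ⟨l, hl, h, rfl⟩
  have hSdot (x) (hx : x ∈ S) (y) (hy : y ∈ S) : treeDot K X x y ∈ S := by
    induction hx, hy using Submodule.span_induction₂ with
    | mem_mem x y hx hy =>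
      obtain ⟨l, hl, h, rfl⟩ := hx
      obtain ⟨m, hm, h', rfl⟩ := hy
      rw [← dotWord_append _ _ treeDot_assoc hl hm]
      refine hword _ (by simp [hl]) fun x hx => ?_
      rcases List.mem_append.1 hx with hx | hx
      exacts [h x hx, h' x hx]
    | zero_left => simp
    | zero_right => simp
    | add_left x y z _ _ _ h h' => simpa using S.add_mem h h'
    | add_right x y z _ _ _ h h' => simpa using S.add_mem h h'
    | smul_left k x y _ _ h => simpa using S.smul_mem k h
    | smul_right k x y _ _ h => simpa using S.smul_mem k h
  have hScirc (a : X) (l) (hl : l ≠ []) (h : ∀ x ∈ l, x ∈ Q) :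
      treeCirc K X (dotWord (treeDot K X) j l) (tr K (.leaf a)) ∈ S := by
    induction l with
    | nil => exact absurd rfl hl
    | cons b l ih =>
      have h1 : treeCirc K X (dotWord (treeDot K X) j (b :: l)) (tr K (.leaf a))
          = (treeOp (b :: l ++ [primLeaf K a])).1 + treeDot K X (j b)
            (prodCirc (treeDot K X) (treeCirc K X) (l.map j) (tr K (.leaf a))) := by
        have : (treeOp (b :: l ++ [primLeaf K a])).1 = _ :=
          (congrArg (nOp (treeDot K X) (treeCirc K X)) (List.map_append ..)).trans
            (nOp_snoc _ _ (j b) (l.map j) (tr K (.leaf a)))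
        rw [this]
        exact (sub_add_cancel _ _).symm
      have h2 : (treeOp (b :: l ++ [primLeaf K a])).1 ∈ S :=
        hword [treeOp (b :: l ++ [primLeaf K a])] (by simp) (by
          intro x hx
          rw [List.mem_singleton.1 hx]
          refine hQop _ (by simp) fun y hy => ?_
          rcases List.mem_append.1 hy with hy | hy
          · exact h y hy
          · rw [List.mem_singleton.1 hy]; exact hQleaf a)
      have h3 : j b ∈ S := hword [b] (by simp) (by simpa using h b (by simp))
      rw [h1]
      refine S.add_mem h2 (hSdot _ h3 _ ?_)
      cases l with
      | nil => exact hword [primLeaf K a] (by simp) (by simpa using hQleaf a)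
      | cons e l => exact ih (by simp) fun x hx => h x (List.mem_cons_of_mem _ hx)
  have hS : ∀ x, x ∈ S := by
    refine treeAlg_generated S (fun a => ?_) hSdot fun x hx a => ?_
    · exact hword [primLeaf K a] (by simp) (by simpa using hQleaf a)
    · induction hx using Submodule.span_induction with
      | mem x hx => obtain ⟨l, hl, h, rfl⟩ := hx; exact hScirc a l hl h
      | zero => simp
      | add x y _ _ h h' => simpa using S.add_mem h h'
      | smul k x _ h => simpa using S.smul_mem k h
  let J := tensorLift (K := K) (B := primitives (treeComul K X)) (dotWord (treeDot K X) j)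
  have hJ := tensorLift_word (B := primitives (treeComul K X))
    (dotWord_multilinear (treeDot K X) j)
  have hF (l) (hl : l ≠ []) (h : ∀ x ∈ l, x ∈ Q) :
      F (dotWord (treeDot K X) j l) = word K l := by
    induction l with
    | nil => exact absurd rfl hl
    | cons a l ih =>
      have ha : F (j a) = TensorAlgebra.ι K a :=
        (hg a).trans (congrArg _ (h a (by simp)).2)
      rcases eq_or_ne l [] with rfl | hl
      · rw [word_singleton]; exact ha
      · rw [dotWord_cons _ _ _ hl, hdot, ha, ih hl fun x hx => h x (List.mem_cons_of_mem _ hx)]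
        rfl
  -- the two claims are linear in `y` and hold for products of elements of `Q`
  have key (y : TreeAlg K X) : J (F y) = y ∧ letter K _ (F y) ∈ P := by
    induction hS y using Submodule.span_induction with
    | mem y hy =>
      obtain ⟨l, hl, h, rfl⟩ := hy
      rw [hF l hl h, letter_word]
      refine ⟨hJ l, ?_⟩
      match l, h with
      | [], _ => exact P.zero_mem
      | [a], h => exact (h a (by simp)).1
      | _ :: _ :: _, _ => exact P.zero_mem
    | zero => simp
    | add y z _ _ h h' => simpa only [map_add, h.1, h'.1, true_and] using P.add_mem h.2 h'.2
    | smul k y _ h => simpa only [map_smul, h.1, true_and] using P.smul_mem k h.2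
  obtain ⟨h1, h2⟩ := key x
  rw [hg, letter_ι] at h2
  have h3 : g x = x := Subtype.ext <| by
    rw [hg] at h1
    have h3 := hJ [g x]
    rw [word_singleton] at h3
    exact h3.symm.trans h1
  exact h3 ▸ h2

end Prim

end CompatAlg

end

open CompatAlg in
theorem mainTheorem2 {K : Type*} [Field K] {V : Type*} [AddCommGroup V] [Module K V]
    {X : Type*} (b : Module.Basis X K V) :
    CompatAlg.IsFreeCompatible (CompatAlg.treeDot K X) (CompatAlg.treeCirc K X)
      (CompatAlg.treeIncl b) ∧
    CompatAlg.IsCompatibleInfBialgebra (CompatAlg.treeDot K X) (CompatAlg.treeCirc K X)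
      (CompatAlg.treeComul K X) ∧
    ∃ (N : List (CompatAlg.primitives (CompatAlg.treeComul K X)) →
          CompatAlg.primitives (CompatAlg.treeComul K X))
      (ι : V →ₗ[K] CompatAlg.primitives (CompatAlg.treeComul K X)),
      (∀ l, 2 ≤ l.length →
        (N l : CompatAlg.TreeAlg K X) =
          CompatAlg.nOp (CompatAlg.treeDot K X) (CompatAlg.treeCirc K X)
            (l.map Subtype.val)) ∧
      (∀ v, (ι v : CompatAlg.TreeAlg K X) = CompatAlg.treeIncl b v) ∧
      CompatAlg.IsFreeNAlgebra N ι := by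
  have hι (a : X) : b.constr K (primLeaf K) (b a) = primLeaf K a := b.constr_basis ..
  refine ⟨treeAlg_isFree b, treeAlg_isCompatibleInfBialgebra, treeOp, b.constr K (primLeaf K),
    fun _ _ => rfl, fun v => ?_, treeOp_isNAlgebra, fun B _ _ N hN f => ?_⟩
  · have : Submodule.subtype _ ∘ₗ b.constr K (primLeaf K) = treeIncl b := b.ext fun a => by
      simp [treeIncl, primLeaf]
    exact LinearMap.congr_fun this v
  · obtain ⟨-, g, -, -, hg, hleaf⟩ := exists_primHom hN fun a => f (b a)
    refine ⟨g, ⟨hg, fun v => ?_⟩, ?_⟩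
    · have : g ∘ₗ b.constr K (primLeaf K) = f := b.ext fun a => by simp [hleaf]
      exact LinearMap.congr_fun this v
    · rintro g' ⟨h1, h2⟩
      refine LinearMap.ext fun x => prim_generated (LinearMap.eqLocus g' g) (fun a => ?_)
        (fun l hl h => ?_) x
      · rw [LinearMap.mem_eqLocus, hleaf, ← h2, hι]
      · rw [LinearMap.mem_eqLocus, h1 l hl, hg l hl, List.map_congr_left h]
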